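/- Let $R$ be a ring with identity and let $\mathcal A$ be a small preadditive category; write $R_A=\operatorname{Hom}(A,A)$. Assume that there are ring homomorphisms $\delta_A\colon R\to R_A$ with $\delta_B(r)\circ f=f\circ\delta_A(r)$ for all $f\colon A\to B$ and $r\in R$, and that for $A\neq B$ every composite $B\to A\to B$ in $\mathcal A$ is zero. Let $\mathrm{Add}(\mathcal A,R\text{-Mod})$ be the category of additive functors $\mathcal A\to R\text{-Mod}$; for such a functor $X$, the group $X(A)$ is a left $R_A$-module by $f\cdot a=X(f)(a)$, and this gives the evaluation functor $\mathrm{ev}_A\colon\mathrm{Add}(\mathcal A,R\text{-Mod})\to R_A\text{-Mod}$. For every object $A$ fix a (Quillen) exact structure $\mathcal E_A$ on $R_A\text{-Mod}$, and equip $\mathrm{Add}(\mathcal A,R\text{-Mod})$ with the exact structure $\mathcal E$ of all kernel–cokernel pairs $\mathbb E$ such that $\mathrm{ev}_B(\mathbb E)\in\mathcal E_B$ for every object $B$. Let $A$ be an object of $\mathcal A$. For an additive functor $X\colon\mathcal A\to R\text{-Mod}$ define $R_A$-linear maps $$\varphi_A^X\colon\bigoplus_{B\ne A}\operatorname{Hom}(B,A)\otimes_{R_B}X(B)\to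 X(A),\quad g\otimes x\mapsto X(g)(x),$$ $$\psi_A^X\colon X(A)\to\prod_{B\neq A}\operatorname{Hom}_{R_B}(\operatorname{Hom}(A,B),X(B)),\quad a\mapsto(g\mapsto X(g)(a))_B,$$ and put $c_A(X)=\operatorname{coker}\varphi_A^X$ and $k_A(X)=\ker\psi_A^X$; these are functors $\mathrm{Add}(\mathcal A,R\text{-Mod})\to R_A\text{-Mod}$. Let $$\phi_{A,X}\colon\Big(\bigoplus_{B,B'\neq A}\operatorname{Hom}(B',A)\otimes_{R_{B'}}\operatorname{Hom}(B,B')\otimes_{R_B}X(B)\Big)\oplus\Big(\bigoplus_{B\ne A}\operatorname{Hom}(B,A)\otimes_{R_B}\operatorname{Hom}(A,B)\otimes_{R_A}X(A)\Big)\to\bigoplus_{B\neq A}\operatorname{Hom}(B,A)\otimes_{R_B}X(B)$$ be the map given by $g\otimes f\otimes x\mapsto g\otimes X(f)(x)-(g\circ f)\otimes x$ on the first summand and by $g\otimes f\otimes x\mapsto g\otimes X(f)(x)$ on the second. Dually, let $\mu_{A,X}$ be the map from $\prod_{B\neq A}\operatorname{Hom}_{R_B}(\operatorname{Hom}(A,B),X(B))$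 to $$\prod_{B,B'\neq A}\operatorname{Hom}_{R_B}\big(\operatorname{Hom}(A,B),\operatorname{Hom}_{R_{B'}}(\operatorname{Hom}(B,B'),X(B'))\big)\times\prod_{B\neq A}\operatorname{Hom}_{R_B}\big(\operatorname{Hom}(A,B),\operatorname{Hom}_{R_A}(\operatorname{Hom}(B,A),X(A))\big)$$ sending $(u_B)_B$ to the pair of families $\big(f\mapsto(g\mapsto X(g)(u_B(f))-u_{B'}(g\circ f))\big)_{B,B'}$ and $\big(f\mapsto(g\mapsto X(g)(u_B(f)))\big)_B$. The map $\varphi_A^X$ induces $\operatorname{coker}\phi_{A,X}\to X(A)$, and $\psi_A^X$ induces $X(A)\to\ker\mu_{A,X}$. Call $X$ $c_A$-flat if $c_A$ sends every short exact sequence $Y\to Z\to X$ in $\mathcal E$ to one in $\mathcal E_A$, and $k_A$-coflat if $k_A$ sends every short exact sequence $X\to Y\to Z$ in $\mathcal E$ to one in $\mathcal E_A$. Then for every additive functor $X\colon\mathcal A\to R\text{-Mod}$: (i) $X$ is $c_A$-flat if and only if the canonical sequence $\operatorname{coker}\phi_{A,X}\to X(A)\to c_A(X)$ is a short exact sequence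 in $(R_A\text{-Mod};\mathcal E_A)$; (ii) $X$ is $k_A$-coflat if and only if the canonical sequence $k_A(X)\to X(A)\to\ker\mu_{A,X}$ is a short exact sequence in $(R_A\text{-Mod};\mathcal E_A)$. Both equivalences also hold when $\mathrm{Add}(\mathcal A,R\text{-Mod})$ is replaced throughout by its full subcategory of those additive functors $X$ for which $X(\delta_B(r))$ is multiplication by $r$ on $X(B)$, for all $B$ and all $r\in R$. -/

import Mathlib

open CategoryTheory CategoryTheory.Limits
open scoped TensorProduct DirectSum

universe u

/-! ## Exact structures and flat / coflat objects -/

section Exact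

variable {C : Type*} [Category C]

/-- `(i, p)` is a kernel-cokernel pair: `i` is a kernel of `p` and `p` is a cokernel of `i`. -/
def IsKernelCokernelPair [HasZeroMorphisms C] (S : ShortComplex C) : Prop :=
  Nonempty (IsLimit (KernelFork.ofι S.f S.zero)) ∧
    Nonempty (IsColimit (CokernelCofork.ofπ S.g S.zero))

/-- `i` is the first morphism of a distinguished sequence. -/
def IsAdmissibleMono [HasZeroMorphisms C] (E : ObjectProperty (ShortComplex C))
    {X Y : C} (i : X ⟶ Y) : Prop :=
  ∃ (Z : C) (p : Y ⟶ Z) (w : i ≫ p = 0), E (ShortComplex.mk i p w)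

/-- `p` is the second morphism of a distinguished sequence. -/
def IsAdmissibleEpi [HasZeroMorphisms C] (E : ObjectProperty (ShortComplex C))
    {Y Z : C} (p : Y ⟶ Z) : Prop :=
  ∃ (X : C) (i : X ⟶ Y) (w : i ≫ p = 0), E (ShortComplex.mk i p w)

/-- A (Quillen) exact structure: an isomorphism-closed class `ses` of kernel-cokernel pairs, the
short exact sequences of the exact category. -/
structure ExactStructure (C : Type*) [Category C] [Preadditive C] where
  ses : ObjectProperty (ShortComplex C)
  isKernelCokernelPair : ∀ S, ses S → IsKernelCokernelPair S
  of_iso : ∀ {S T : ShortComplex C}, (S ≅ T) → ses S → ses T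
  id_mono : ∀ X : C, IsAdmissibleMono ses (𝟙 X)
  id_epi : ∀ X : C, IsAdmissibleEpi ses (𝟙 X)
  comp_mono : ∀ {X Y Z : C} (i : X ⟶ Y) (j : Y ⟶ Z),
    IsAdmissibleMono ses i → IsAdmissibleMono ses j → IsAdmissibleMono ses (i ≫ j)
  comp_epi : ∀ {X Y Z : C} (p : X ⟶ Y) (q : Y ⟶ Z),
    IsAdmissibleEpi ses p → IsAdmissibleEpi ses q → IsAdmissibleEpi ses (p ≫ q)
  pushout : ∀ {X Y X' : C} (i : X ⟶ Y) (f : X ⟶ X'), IsAdmissibleMono ses i →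
    ∃ (Y' : C) (f' : Y ⟶ Y') (i' : X' ⟶ Y'), IsPushout i f f' i' ∧ IsAdmissibleMono ses i'
  pullback : ∀ {Y Z Z' : C} (p : Y ⟶ Z) (g : Z' ⟶ Z), IsAdmissibleEpi ses p →
    ∃ (Y' : C) (g' : Y' ⟶ Y) (p' : Y' ⟶ Z'), IsPullback g' p' p g ∧ IsAdmissibleEpi ses p'

variable {D : Type*} [Category D]

/-- `X` is `F`-flat: `F` sends every short exact sequence ending with `X` to a short exact
sequence. -/
def IsFlatObject [HasZeroMorphisms C] [HasZeroMorphisms D]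
    (EC : ObjectProperty (ShortComplex C)) (ED : ObjectProperty (ShortComplex D))
    (F : C ⥤ D) [F.PreservesZeroMorphisms] (X : C) : Prop :=
  ∀ (Y Z : C) (i : Y ⟶ Z) (p : Z ⟶ X) (w : i ≫ p = 0),
    EC (ShortComplex.mk i p w) → ED ((ShortComplex.mk i p w).map F)

/-- `X` is `F`-coflat: `F` sends every short exact sequence beginning with `X` to a short exact
sequence. -/
def IsCoflatObject [HasZeroMorphisms C] [HasZeroMorphisms D]
    (EC : ObjectProperty (ShortComplex C)) (ED : ObjectProperty (ShortComplex D))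
    (F : C ⥤ D) [F.PreservesZeroMorphisms] (X : C) : Prop :=
  ∀ (Y Z : C) (i : X ⟶ Y) (p : Y ⟶ Z) (w : i ≫ p = 0),
    EC (ShortComplex.mk i p w) → ED ((ShortComplex.mk i p w).map F)

end Exact

noncomputable section

variable {R : Type u} [Ring R] {𝒜 : Type u} [SmallCategory 𝒜] [Preadditive 𝒜]

/-! ## Evaluation functors

For an object `A` the endomorphism ring `R_A` is `End A`, whose product is composition
(`f * g = g ≫ f`). -/

/-- The underlying group of `X(A)`, viewed below as a left `R_A`-module. -/
def Ev (A : 𝒜) (X : 𝒜 ⥤+ ModuleCat.{u} R) : Type u := X.obj.obj A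

instance (A : 𝒜) (X : 𝒜 ⥤+ ModuleCat.{u} R) : AddCommGroup (Ev A X) :=
  inferInstanceAs (AddCommGroup (X.obj.obj A))

/-- The homomorphism `X(f) : X(B) → X(B')`. -/
def actHom (X : 𝒜 ⥤+ ModuleCat.{u} R) {B B' : 𝒜} (f : B ⟶ B') : Ev B X →+ Ev B' X :=
  (X.obj.map f).hom.toAddMonoidHom

section

variable (X : 𝒜 ⥤+ ModuleCat.{u} R)

theorem actHom_id (B : 𝒜) (x : Ev B X) : actHom X (𝟙 B) x = x := by
  change (X.obj.map (𝟙 B)).hom x = x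
  rw [CategoryTheory.Functor.map_id]
  rfl

theorem actHom_comp {B B' B'' : 𝒜} (f : B ⟶ B') (g : B' ⟶ B'') (x : Ev B X) :
    actHom X (f ≫ g) x = actHom X g (actHom X f x) := by
  change (X.obj.map (f ≫ g)).hom x = (X.obj.map g).hom ((X.obj.map f).hom x)
  rw [Functor.map_comp]
  rfl

theorem actHom_add {B B' : 𝒜} (f g : B ⟶ B') :
    actHom X (f + g) = actHom X f + actHom X g := by
  ext x
  change (X.obj.map (f + g)).hom x = (X.obj.map f).hom x + (X.obj.map g).hom x
  rw [Functor.map_add]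
  rfl

theorem actHom_zero {B B' : 𝒜} : actHom X (0 : B ⟶ B') = 0 := by
  ext x
  change (X.obj.map (0 : B ⟶ B')).hom x = 0
  rw [Functor.map_zero]
  rfl

/-- `f ↦ X(f)` as an additive map. -/
def actBi (B B' : 𝒜) : (B ⟶ B') →+ Ev B X →+ Ev B' X :=
  AddMonoidHom.mk' (actHom X) (actHom_add X)

@[simp] theorem actBi_apply {B B' : 𝒜} (f : B ⟶ B') (x : Ev B X) :
    actBi X B B' f x = actHom X f x := rfl

/-- The left `R_A`-module structure `f • a = X(f)(a)` on `X(A)`. -/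
instance (A : 𝒜) : Module (End A) (Ev A X) where
  smul f a := actHom X (End.asHom f) a
  one_smul := actHom_id X A
  mul_smul f g a := actHom_comp X (End.asHom g) (End.asHom f) a
  smul_zero f := map_zero (actHom X f)
  smul_add f := map_add (actHom X f)
  add_smul f g a := DFunLike.congr_fun (actHom_add X f g) a
  zero_smul a := DFunLike.congr_fun (actHom_zero X) a

theorem end_smul {A : 𝒜} (f : End A) (x : Ev A X) : f • x = actHom X (End.asHom f) x := rfl

end

/-- The component `α_A : X(A) → Y(A)`, which is `R_A`-linear. -/
def evMap (A : 𝒜) {X Y : 𝒜 ⥤+ ModuleCat.{u} R} (α : X ⟶ Y) : Ev A X →ₗ[End A] Ev A Y where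
  toFun := fun x => (α.hom.app A).hom x
  map_add' := fun x y => map_add (α.hom.app A).hom x y
  map_smul' f x := NatTrans.naturality_apply α.hom f x

theorem evMap_act {X Y : 𝒜 ⥤+ ModuleCat.{u} R} (α : X ⟶ Y) {B B' : 𝒜} (f : B ⟶ B')
    (x : Ev B X) : evMap B' α (actHom X f x) = actHom Y f (evMap B α x) :=
  NatTrans.naturality_apply α.hom f x

/-- The evaluation functor `ev_A : Add(𝒜, R-Mod) → R_A-Mod`. -/
def ev (A : 𝒜) : (𝒜 ⥤+ ModuleCat.{u} R) ⥤ ModuleCat.{u} (End A) where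
  obj X := ModuleCat.of (End A) (Ev A X)
  map α := ModuleCat.ofHom (evMap A α)

instance (A : 𝒜) : (ev (R := R) A).Additive where
  map_add := by intros; rfl

/-- The short exact sequences of the degreewise exact structure on a category `𝒞` equipped with
evaluation functors `e A : 𝒞 ⥤ R_A-Mod`: the kernel-cokernel pairs in `𝒞` all of whose evaluations
are short exact in `(R_A-Mod; E_A)`. -/
def degreewise {𝒞 : Type*} [Category 𝒞] [HasZeroMorphisms 𝒞]
    (e : ∀ A : 𝒜, 𝒞 ⥤ ModuleCat.{u} (End A)) [∀ A, (e A).PreservesZeroMorphisms]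
    (E : ∀ A : 𝒜, ExactStructure (ModuleCat.{u} (End A))) : ObjectProperty (ShortComplex 𝒞) :=
  fun S => IsKernelCokernelPair S ∧ ∀ A, (E A).ses (S.map (e A))

/-! ## Tensor products `Hom(B, A) ⊗_{R_B} Y` -/

section Tensor

variable (B A : 𝒜) (Y : Type u) [AddCommGroup Y] [Module (End B) Y]

/-- The submodule of `Hom(B, A) ⊗_ℤ Y` generated by `(g ∘ s) ⊗ y - g ⊗ (s • y)`, `s ∈ R_B`. -/
def homTensorRel : Submodule (End A) ((B ⟶ A) ⊗[ℤ] Y) :=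
  Submodule.span (End A) {t | ∃ (s : End B) (g : B ⟶ A) (y : Y),
    t = (End.asHom s ≫ g) ⊗ₜ[ℤ] y - g ⊗ₜ[ℤ] (s • y)}

/-- The left `R_A`-module `Hom(B, A) ⊗_{R_B} Y`. -/
def HomTensor : Type u := ((B ⟶ A) ⊗[ℤ] Y) ⧸ homTensorRel B A Y

instance : AddCommGroup (HomTensor B A Y) :=
  inferInstanceAs (AddCommGroup (((B ⟶ A) ⊗[ℤ] Y) ⧸ homTensorRel B A Y))

instance : Module (End A) (HomTensor B A Y) :=
  inferInstanceAs (Module (End A) (((B ⟶ A) ⊗[ℤ] Y) ⧸ homTensorRel B A Y))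

variable {B A Y}

/-- The element `g ⊗ y`. -/
def HomTensor.tmul (g : B ⟶ A) (y : Y) : HomTensor B A Y :=
  (homTensorRel B A Y).mkQ (g ⊗ₜ[ℤ] y)

theorem HomTensor.smul_tmul' (t : End A) (g : B ⟶ A) (y : Y) :
    t • HomTensor.tmul g y = HomTensor.tmul (g ≫ End.asHom t) y := rfl

theorem HomTensor.tmul_smul (s : End B) (g : B ⟶ A) (y : Y) :
    HomTensor.tmul g (s • y) = HomTensor.tmul (End.asHom s ≫ g) y := by
  symm
  rw [← sub_eq_zero]
  exact (Submodule.Quotient.mk_eq_zero _).2 (Submodule.subset_span ⟨s, g, y, rfl⟩)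

theorem HomTensor.add_tmul (g g' : B ⟶ A) (y : Y) :
    HomTensor.tmul (g + g') y = HomTensor.tmul g y + HomTensor.tmul g' y := by
  simp only [HomTensor.tmul, TensorProduct.add_tmul]
  exact map_add _ _ _

theorem HomTensor.tmul_add (g : B ⟶ A) (y y' : Y) :
    HomTensor.tmul g (y + y') = HomTensor.tmul g y + HomTensor.tmul g y' := by
  simp only [HomTensor.tmul, TensorProduct.tmul_add]
  exact map_add _ _ _

/-- `(g, y) ↦ g ⊗ y` as a biadditive map. -/
def HomTensor.tmulBi (B A : 𝒜) (Y : Type u) [AddCommGroup Y] [Module (End B) Y] :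
    (B ⟶ A) →+ Y →+ HomTensor B A Y :=
  AddMonoidHom.mk' (fun g => AddMonoidHom.mk' (HomTensor.tmul g) (HomTensor.tmul_add g))
    (fun g g' => by ext y; exact HomTensor.add_tmul g g' y)

@[simp] theorem HomTensor.tmulBi_apply (g : B ⟶ A) (y : Y) :
    HomTensor.tmulBi B A Y g y = HomTensor.tmul g y := rfl

@[elab_as_elim]
theorem HomTensor.induction {p : HomTensor B A Y → Prop} (zero : p 0)
    (tmul : ∀ g y, p (HomTensor.tmul g y)) (add : ∀ a b, p a → p b → p (a + b))
    (z : HomTensor B A Y) : p z := by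
  obtain ⟨t, rfl⟩ := Submodule.mkQ_surjective (homTensorRel B A Y) z
  induction t with
  | zero => exact zero
  | tmul g y => exact tmul g y
  | add a b ha hb =>
    rw [map_add]
    exact add _ _ ha hb

/-- The universal property of `Hom(B, A) ⊗_{R_B} Y`, for homomorphisms of abelian groups. -/
def HomTensor.liftAdd {P : Type u} [AddCommGroup P] (b : (B ⟶ A) →+ Y →+ P)
    (hbal : ∀ (s : End B) g y, b (End.asHom s ≫ g) y = b g (s • y)) :
    HomTensor B A Y →+ P :=
  let T : (B ⟶ A) ⊗[ℤ] Y →+ P := TensorProduct.liftAddHom b (fun r m n => by simp)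
  QuotientAddGroup.lift (homTensorRel B A Y).toAddSubgroup T (fun x hx => by
    suffices h : ∀ x ∈ homTensorRel B A Y, ∀ t : End A, T (t • x) = 0 by
      have h1 := h x hx 1
      rwa [one_smul] at h1
    clear hx x
    intro x hx
    induction hx using Submodule.span_induction with
    | mem x h =>
      obtain ⟨s, g, y, rfl⟩ := h
      intro t
      rw [smul_sub, map_sub, sub_eq_zero]
      change b ((End.asHom s ≫ g) ≫ End.asHom t) y = b (g ≫ End.asHom t) (s • y)
      rw [Category.assoc, hbal]
    | zero => simp
    | add x y hx hy h h' =>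
      intro t
      rw [smul_add, map_add, h, h', add_zero]
    | smul a x hx h =>
      intro t
      rw [smul_smul, h])

@[simp] theorem HomTensor.liftAdd_tmul {P : Type u} [AddCommGroup P] (b : (B ⟶ A) →+ Y →+ P)
    (hbal) (g : B ⟶ A) (y : Y) :
    HomTensor.liftAdd b hbal (HomTensor.tmul g y) = b g y := rfl

variable {P : Type u} [AddCommGroup P] [Module (End A) P]

/-- The universal property of `Hom(B, A) ⊗_{R_B} Y`, for homomorphisms of `R_A`-modules. -/
def HomTensor.lift (b : (B ⟶ A) →+ Y →+ P)
    (hbal : ∀ (s : End B) g y, b (End.asHom s ≫ g) y = b g (s • y))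
    (hlin : ∀ (t : End A) g y, b (g ≫ End.asHom t) y = t • b g y) :
    HomTensor B A Y →ₗ[End A] P :=
  { HomTensor.liftAdd b hbal with
    map_smul' := fun t z => by
      change HomTensor.liftAdd b hbal (t • z) = t • HomTensor.liftAdd b hbal z
      induction z using HomTensor.induction with
      | zero => simp
      | tmul g y => exact hlin t g y
      | add z z' h h' => rw [smul_add, map_add, map_add, smul_add, h, h'] }

@[simp] theorem HomTensor.lift_tmul (b : (B ⟶ A) →+ Y →+ P) (hbal) (hlin) (g : B ⟶ A) (y : Y) :
    HomTensor.lift b hbal hlin (HomTensor.tmul g y) = b g y := rfl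

variable (A)

/-- `id ⊗ u : Hom(B, A) ⊗_{R_B} Y → Hom(B, A) ⊗_{R_B} Y'`. -/
def HomTensor.map {Y' : Type u} [AddCommGroup Y'] [Module (End B) Y'] (u : Y →ₗ[End B] Y') :
    HomTensor B A Y →ₗ[End A] HomTensor B A Y' :=
  HomTensor.lift
    (AddMonoidHom.mk' (fun g => (HomTensor.tmulBi B A Y' g).comp u.toAddMonoidHom)
      (fun g g' => by ext y; simp))
    (fun s g y => by simp [HomTensor.tmul_smul])
    (fun t g y => rfl)

@[simp] theorem HomTensor.map_tmul {Y' : Type u} [AddCommGroup Y'] [Module (End B) Y']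
    (u : Y →ₗ[End B] Y') (g : B ⟶ A) (y : Y) :
    HomTensor.map A u (HomTensor.tmul g y) = HomTensor.tmul g (u y) := rfl

variable (B Y)

/-- For fixed `g : B' ⟶ A`, the map `f ⊗ y ↦ (g ∘ f) ⊗ y`. -/
def HomTensor.postcomp {B' : 𝒜} (g : B' ⟶ A) : HomTensor B B' Y →+ HomTensor B A Y :=
  HomTensor.liftAdd
    (AddMonoidHom.mk' (fun f => HomTensor.tmulBi B A Y (f ≫ g)) (fun f f' => by simp))
    (fun s f y => by simp [HomTensor.tmul_smul])

theorem HomTensor.postcomp_tmul {B' : 𝒜} (g : B' ⟶ A) (f : B ⟶ B') (y : Y) :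
    HomTensor.postcomp B A Y g (HomTensor.tmul f y) = HomTensor.tmul (f ≫ g) y := rfl

/-- `∘ ⊗ id : Hom(B', A) ⊗_{R_B'} Hom(B, B') ⊗_{R_B} Y → Hom(B, A) ⊗_{R_B} Y`,
`g ⊗ f ⊗ y ↦ (g ∘ f) ⊗ y`. -/
def HomTensor.comp (B' : 𝒜) :
    HomTensor B' A (HomTensor B B' Y) →ₗ[End A] HomTensor B A Y :=
  HomTensor.lift
    (AddMonoidHom.mk' (HomTensor.postcomp B A Y) (fun g g' => by
      ext z
      induction z using HomTensor.induction with
      | zero => simp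
      | tmul f y =>
        simp [HomTensor.postcomp_tmul, HomTensor.add_tmul]
      | add a b ha hb => rw [map_add, map_add, ha, hb]))
    (fun s g z => by
      induction z using HomTensor.induction with
      | zero => simp
      | tmul f y =>
        simp [HomTensor.postcomp_tmul, HomTensor.smul_tmul']
      | add a b ha hb => rw [smul_add, map_add, map_add, ha, hb])
    (fun t g z => by
      induction z using HomTensor.induction with
      | zero => simp
      | tmul f y =>
        simp [HomTensor.postcomp_tmul, HomTensor.smul_tmul']
      | add a b ha hb => rw [map_add, map_add, smul_add, ha, hb])

@[simp] theorem HomTensor.comp_tmul (B' : 𝒜) (g : B' ⟶ A) (f : B ⟶ B') (y : Y) :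
    HomTensor.comp B A Y B' (HomTensor.tmul g (HomTensor.tmul f y)) =
      HomTensor.tmul (f ≫ g) y := rfl

end Tensor

/-! ## The functor `c_A` -/

section Coker

variable (X : 𝒜 ⥤+ ModuleCat.{u} R)

/-- `Hom(B, A) ⊗_{R_B} X(B) → X(A)`, `g ⊗ x ↦ X(g)(x)`. -/
def tensorAct (B A : 𝒜) : HomTensor B A (Ev B X) →ₗ[End A] Ev A X :=
  HomTensor.lift (actBi X B A) (fun s g x => actHom_comp X s g x)
    (fun t g x => actHom_comp X g t x)

@[simp] theorem tensorAct_tmul {B A : 𝒜} (g : B ⟶ A) (x : Ev B X) :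
    tensorAct X B A (HomTensor.tmul g x) = actHom X g x := rfl

variable (A : 𝒜)

/-- `⨁_{B ≠ A} Hom(B, A) ⊗_{R_B} X(B)`. -/
abbrev TensorSum : Type u := ⨁ B : {B : 𝒜 // B ≠ A}, HomTensor B.1 A (Ev B.1 X)

/-- `⨁_{B, B' ≠ A} Hom(B', A) ⊗_{R_B'} Hom(B, B') ⊗_{R_B} X(B)`, over pairs `(B, B')`. -/
abbrev TensorSum₂ : Type u := ⨁ p : {B : 𝒜 // B ≠ A} × {B : 𝒜 // B ≠ A},
  HomTensor p.2.1 A (HomTensor p.1.1 p.2.1 (Ev p.1.1 X))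

/-- `⨁_{B ≠ A} Hom(B, A) ⊗_{R_B} Hom(A, B) ⊗_{R_A} X(A)`. -/
abbrev TensorSumA : Type u := ⨁ B : {B : 𝒜 // B ≠ A},
  HomTensor B.1 A (HomTensor A B.1 (Ev A X))

open Classical in
/-- `φ_A^X : ⨁_{B ≠ A} Hom(B, A) ⊗_{R_B} X(B) → X(A)` (written with a `varphi`). -/
def varphi : TensorSum X A →ₗ[End A] Ev A X :=
  DirectSum.toModule (End A) _ _ (fun B => tensorAct X B.1 A)

open Classical in
/-- `h¹`, given by `g ⊗ f ⊗ x ↦ g ⊗ X(f)(x)`. -/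
def h₁ : TensorSum₂ X A →ₗ[End A] TensorSum X A :=
  DirectSum.toModule (End A) _ _ (fun p =>
    DirectSum.lof (End A) _ (fun B : {B : 𝒜 // B ≠ A} => HomTensor B.1 A (Ev B.1 X)) p.2 ∘ₗ
      HomTensor.map A (tensorAct X p.1.1 p.2.1))

open Classical in
/-- `h²`, given by `g ⊗ f ⊗ x ↦ (g ∘ f) ⊗ x`. -/
def h₂ : TensorSum₂ X A →ₗ[End A] TensorSum X A :=
  DirectSum.toModule (End A) _ _ (fun p =>
    DirectSum.lof (End A) _ (fun B : {B : 𝒜 // B ≠ A} => HomTensor B.1 A (Ev B.1 X)) p.1 ∘ₗ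
      HomTensor.comp p.1.1 A (Ev p.1.1 X) p.2.1)

open Classical in
/-- `ν`, given by `g ⊗ f ⊗ x ↦ g ⊗ X(f)(x)`. -/
def nu : TensorSumA X A →ₗ[End A] TensorSum X A :=
  DirectSum.toModule (End A) _ _ (fun B =>
    DirectSum.lof (End A) _ (fun B : {B : 𝒜 // B ≠ A} => HomTensor B.1 A (Ev B.1 X)) B ∘ₗ
      HomTensor.map A (tensorAct X A B.1))

/-- `φ_{A,X} = (h¹ - h², ν)`. -/
def phi : (TensorSum₂ X A × TensorSumA X A) →ₗ[End A] TensorSum X A :=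
  (h₁ X A - h₂ X A).coprod (nu X A)

/-- `c_A(X) = coker (varphi_A^X)`. -/
abbrev CObj : Type u := Ev A X ⧸ LinearMap.range (varphi X A)

/-- `coker (φ_{A,X})`. -/
abbrev CokerPhi : Type u := TensorSum X A ⧸ LinearMap.range (phi X A)

variable {X}

theorem range_varphi_le {Y : 𝒜 ⥤+ ModuleCat.{u} R} (α : X ⟶ Y) :
    LinearMap.range (varphi X A) ≤ (LinearMap.range (varphi Y A)).comap (evMap A α) := by
  classical
  rintro _ ⟨z, rfl⟩
  induction z using DirectSum.induction_on with
  | zero => simp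
  | add a b ha hb => rw [map_add]; exact add_mem ha hb
  | of B z =>
    induction z using HomTensor.induction with
    | zero => simp
    | add a b ha hb => rw [map_add, map_add]; exact add_mem ha hb
    | tmul g x =>
      refine ⟨DirectSum.lof (End A) _ (fun B : {B : 𝒜 // B ≠ A} =>
        HomTensor B.1 A (Ev B.1 Y)) B (HomTensor.tmul g (evMap B.1 α x)), ?_⟩
      change varphi Y A _ = evMap A α (varphi X A (DirectSum.lof (End A) _ _ B _))
      rw [varphi, varphi, DirectSum.toModule_lof, DirectSum.toModule_lof, tensorAct_tmul,
        tensorAct_tmul, evMap_act]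

/-- The functor `c_A : Add(𝒜, R-Mod) → R_A-Mod`. -/
def cFunctor : (𝒜 ⥤+ ModuleCat.{u} R) ⥤ ModuleCat.{u} (End A) where
  obj X := ModuleCat.of (End A) (CObj X A)
  map α := ModuleCat.ofHom (Submodule.mapQ _ _ (evMap A α) (range_varphi_le A α))
  map_id X := by
    ext x
    rfl
  map_comp α β := by
    ext x
    rfl

instance : (cFunctor (R := R) A).Additive where
  map_add := by
    intro X Y f g
    ext x
    obtain ⟨x, rfl⟩ := Submodule.mkQ_surjective _ x
    rfl

/-- For `A ≠ B` every composite `B → A → B` is zero. -/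
def HasZeroRoundTrips (𝒜 : Type u) [SmallCategory 𝒜] [Preadditive 𝒜] : Prop :=
  ∀ A B : 𝒜, A ≠ B → ∀ (f : B ⟶ A) (g : A ⟶ B), f ≫ g = 0

variable (X)

theorem range_phi_le (h𝒜 : HasZeroRoundTrips 𝒜) :
    LinearMap.range (phi X A) ≤ LinearMap.ker (varphi X A) := by
  classical
  rintro _ ⟨⟨z, w⟩, rfl⟩
  rw [LinearMap.mem_ker, phi, LinearMap.coprod_apply, map_add, LinearMap.sub_apply, map_sub]
  have hz : varphi X A (h₁ X A z) = varphi X A (h₂ X A z) := by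
    induction z using DirectSum.induction_on with
    | zero => simp
    | add a b ha hb => simp only [map_add, ha, hb]
    | of p z =>
      induction z using HomTensor.induction with
      | zero => simp
      | add a b ha hb => simp only [map_add, ha, hb]
      | tmul g z =>
        induction z using HomTensor.induction with
        | zero =>
          rw [← HomTensor.tmulBi_apply, map_zero]
          simp only [map_zero]
        | add a b ha hb =>
          simp only [HomTensor.tmul_add, map_add, ha, hb]
        | tmul f x =>
          change varphi X A (h₁ X A (DirectSum.lof (End A) _ _ p _)) =
            varphi X A (h₂ X A (DirectSum.lof (End A) _ _ p _))
          simp only [h₁, h₂, varphi, DirectSum.toModule_lof, LinearMap.comp_apply,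
            HomTensor.map_tmul, HomTensor.comp_tmul, tensorAct_tmul, actHom_comp]
  have hw : varphi X A (nu X A w) = 0 := by
    induction w using DirectSum.induction_on with
    | zero => simp
    | add a b ha hb => simp only [map_add, ha, hb, add_zero]
    | of B z =>
      induction z using HomTensor.induction with
      | zero => simp
      | add a b ha hb => simp only [map_add, ha, hb, add_zero]
      | tmul g z =>
        induction z using HomTensor.induction with
        | zero =>
          rw [← HomTensor.tmulBi_apply, map_zero]
          simp only [map_zero]
        | add a b ha hb =>
          simp only [HomTensor.tmul_add, map_add, ha, hb, add_zero]
        | tmul f x =>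
          change varphi X A (nu X A (DirectSum.lof (End A) _ _ B _)) = 0
          simp only [nu, varphi, DirectSum.toModule_lof, LinearMap.comp_apply,
            HomTensor.map_tmul, tensorAct_tmul, ← actHom_comp]
          rw [h𝒜 B.1 A B.2 f g, actHom_zero]
          rfl
  rw [hz, hw, sub_self, add_zero]

/-- The canonical sequence `coker (φ_{A,X}) → X(A) → c_A(X)`, whose first homomorphism is induced
by `varphi_A^X` and whose second one is the quotient map. -/
def cSequence (h𝒜 : HasZeroRoundTrips 𝒜) : ShortComplex (ModuleCat.{u} (End A)) where
  X₁ := ModuleCat.of (End A) (CokerPhi X A)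
  X₂ := ModuleCat.of (End A) (Ev A X)
  X₃ := ModuleCat.of (End A) (CObj X A)
  f := ModuleCat.ofHom ((LinearMap.range (phi X A)).liftQ (varphi X A) (range_phi_le X A h𝒜))
  g := ModuleCat.ofHom (LinearMap.range (varphi X A)).mkQ
  zero := by
    ext x
    exact (Submodule.Quotient.mk_eq_zero _).2 ⟨x, rfl⟩

end Coker

/-! ## The left `R_A`-modules `Hom_{R_B}(Hom(A, B), Y)` -/

section HomModule

variable (A B : 𝒜) (Y : Type u) [AddCommGroup Y] [Module (End B) Y]

/-- `Hom_{R_B}(Hom(A, B), Y)`. -/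
def HomModule : Type u := (A ⟶ B) →ₗ[End B] Y

instance : AddCommGroup (HomModule A B Y) :=
  inferInstanceAs (AddCommGroup ((A ⟶ B) →ₗ[End B] Y))

instance : FunLike (HomModule A B Y) (A ⟶ B) Y :=
  inferInstanceAs (FunLike ((A ⟶ B) →ₗ[End B] Y) (A ⟶ B) Y)

instance : LinearMapClass (HomModule A B Y) (End B) (A ⟶ B) Y :=
  inferInstanceAs (LinearMapClass ((A ⟶ B) →ₗ[End B] Y) (End B) (A ⟶ B) Y)

variable {A B Y}

@[ext] theorem HomModule.ext {u v : HomModule A B Y} (h : ∀ g, u g = v g) : u = v :=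
  LinearMap.ext h

@[simp] theorem HomModule.add_apply (u v : HomModule A B Y) (g : A ⟶ B) :
    (u + v) g = u g + v g := rfl

@[simp] theorem HomModule.zero_apply (g : A ⟶ B) : (0 : HomModule A B Y) g = 0 := rfl

/-- The left `R_A`-module structure `(s • u)(g) = u(g ∘ s)`. -/
instance : Module (End A) (HomModule A B Y) where
  smul s u :=
    ({ toFun := fun g => u (End.asHom s ≫ g)
       map_add' := fun g g' => by rw [Preadditive.comp_add, map_add]
       map_smul' := fun t g => by
        rw [RingHom.id_apply, ← map_smul]
        congr 1
        exact (Category.assoc _ _ _).symm } : (A ⟶ B) →ₗ[End B] Y)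
  one_smul u := HomModule.ext fun g => congrArg u (Category.id_comp g)
  mul_smul s t u := HomModule.ext fun g => congrArg u (Category.assoc _ _ _)
  smul_zero _ := rfl
  smul_add _ _ _ := rfl
  add_smul s t u := HomModule.ext fun g => by
    change u ((End.asHom s + End.asHom t) ≫ g) = u (End.asHom s ≫ g) + u (End.asHom t ≫ g)
    rw [Preadditive.add_comp, map_add]
  zero_smul u := HomModule.ext fun g => by
    change u ((0 : A ⟶ A) ≫ g) = 0
    rw [zero_comp, map_zero]

theorem HomModule.smul_apply (s : End A) (u : HomModule A B Y) (g : A ⟶ B) :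
    (s • u) g = u (End.asHom s ≫ g) := rfl

variable (A)

/-- Postcomposition `Hom_{R_B}(Hom(A, B), Y) → Hom_{R_B}(Hom(A, B), Y')` with `v : Y → Y'`. -/
def HomModule.map {Y' : Type u} [AddCommGroup Y'] [Module (End B) Y'] (v : Y →ₗ[End B] Y') :
    HomModule A B Y →ₗ[End A] HomModule A B Y' where
  toFun u := v ∘ₗ u
  map_add' u u' := HomModule.ext fun g => map_add v (u g) (u' g)
  map_smul' _ _ := rfl

theorem HomModule.map_apply {Y' : Type u} [AddCommGroup Y'] [Module (End B) Y']
    (v : Y →ₗ[End B] Y') (u : HomModule A B Y) (g : A ⟶ B) :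
    HomModule.map A v u g = v (u g) := rfl

variable (B Y)

/-- `Hom_{R_B'}(Hom(A, B'), Y) → Hom_{R_B}(Hom(A, B), Hom_{R_B'}(Hom(B, B'), Y))`, the transpose of
precomposition with the composition rule: `u ↦ (f ↦ (g ↦ u(g ∘ f)))`. -/
def HomModule.comp (B' : 𝒜) (Y : Type u) [AddCommGroup Y] [Module (End B') Y] :
    HomModule A B' Y →ₗ[End A] HomModule A B (HomModule B B' Y) where
  toFun u :=
    ({ toFun := fun f =>
        ({ toFun := fun g => u (f ≫ g)
           map_add' := fun g g' => by rw [Preadditive.comp_add, map_add]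
           map_smul' := fun t g => by
            rw [RingHom.id_apply, ← map_smul]
            congr 1
            exact (Category.assoc _ _ _).symm } : (B ⟶ B') →ₗ[End B'] Y)
       map_add' := fun f f' => HomModule.ext fun g => by
        change u ((f + f') ≫ g) = u (f ≫ g) + u (f' ≫ g)
        rw [Preadditive.add_comp, map_add]
       map_smul' := fun t f => HomModule.ext fun g => congrArg u (Category.assoc _ _ _) } :
      (A ⟶ B) →ₗ[End B] HomModule B B' Y)
  map_add' _ _ := rfl
  map_smul' s u := HomModule.ext fun f => HomModule.ext fun g =>
    congrArg u (Category.assoc _ _ _).symm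

theorem HomModule.comp_apply (B' : 𝒜) (Y : Type u) [AddCommGroup Y] [Module (End B') Y]
    (u : HomModule A B' Y) (f : A ⟶ B) (g : B ⟶ B') :
    HomModule.comp A B B' Y u f g = u (f ≫ g) := rfl

end HomModule

/-! ## The functor `k_A` -/

section Ker

variable (X : 𝒜 ⥤+ ModuleCat.{u} R)

/-- `X(A) → Hom_{R_B}(Hom(A, B), X(B))`, `a ↦ (g ↦ X(g)(a))`. -/
def coAct (A B : 𝒜) : Ev A X →ₗ[End A] HomModule A B (Ev B X) where
  toFun a :=
    ({ toFun := fun g => actHom X g a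
       map_add' := fun g g' => DFunLike.congr_fun (actHom_add X g g') a
       map_smul' := fun t g => actHom_comp X g t a } : (A ⟶ B) →ₗ[End B] Ev B X)
  map_add' a a' := HomModule.ext fun g => map_add (actHom X g) a a'
  map_smul' s a := HomModule.ext fun g => (actHom_comp X s g a).symm

theorem coAct_apply {A B : 𝒜} (a : Ev A X) (g : A ⟶ B) : coAct X A B a g = actHom X g a := rfl

variable (A : 𝒜)

/-- `∏_{B ≠ A} Hom_{R_B}(Hom(A, B), X(B))`. -/
abbrev HomProd : Type u := ∀ B : {B : 𝒜 // B ≠ A}, HomModule A B.1 (Ev B.1 X)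

/-- `∏_{B, B' ≠ A} Hom_{R_B}(Hom(A, B), Hom_{R_B'}(Hom(B, B'), X(B')))`, over pairs `(B, B')`. -/
abbrev HomProd₂ : Type u := ∀ p : {B : 𝒜 // B ≠ A} × {B : 𝒜 // B ≠ A},
  HomModule A p.1.1 (HomModule p.1.1 p.2.1 (Ev p.2.1 X))

/-- `∏_{B ≠ A} Hom_{R_B}(Hom(A, B), Hom_{R_A}(Hom(B, A), X(A)))`. -/
abbrev HomProdA : Type u := ∀ B : {B : 𝒜 // B ≠ A},
  HomModule A B.1 (HomModule B.1 A (Ev A X))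

/-- `ψ_A^X : X(A) → ∏_{B ≠ A} Hom_{R_B}(Hom(A, B), X(B))`. -/
def psi : Ev A X →ₗ[End A] HomProd X A :=
  LinearMap.pi fun B => coAct X A B.1

/-- `t¹`, given by `(u_B)_B ↦ (f ↦ g ↦ X(g)(u_B(f)))_{(B, B')}`. -/
def t₁ : HomProd X A →ₗ[End A] HomProd₂ X A :=
  LinearMap.pi fun p => HomModule.map A (coAct X p.1.1 p.2.1) ∘ₗ LinearMap.proj p.1

/-- `t²`, given by `(u_B)_B ↦ (f ↦ g ↦ u_{B'}(g ∘ f))_{(B, B')}`. -/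
def t₂ : HomProd X A →ₗ[End A] HomProd₂ X A :=
  LinearMap.pi fun p => HomModule.comp A p.1.1 p.2.1 (Ev p.2.1 X) ∘ₗ LinearMap.proj p.2

/-- `τ`, given by `(u_B)_B ↦ (f ↦ g ↦ X(g)(u_B(f)))_B` with `f : A → B` and `g : B → A`. -/
def tau : HomProd X A →ₗ[End A] HomProdA X A :=
  LinearMap.pi fun B => HomModule.map A (coAct X B.1 A) ∘ₗ LinearMap.proj B

/-- `μ_{A,X} = (t¹ - t², τ)`. -/
def mu : HomProd X A →ₗ[End A] HomProd₂ X A × HomProdA X A :=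
  (t₁ X A - t₂ X A).prod (tau X A)

/-- `k_A(X) = ker (ψ_A^X)`. -/
abbrev KObj : Type u := LinearMap.ker (psi X A)

/-- `ker (μ_{A,X})`. -/
abbrev KerMu : Type u := LinearMap.ker (mu X A)

variable {X}

theorem ker_psi_le {Y : 𝒜 ⥤+ ModuleCat.{u} R} (α : X ⟶ Y) (x : Ev A X)
    (hx : x ∈ LinearMap.ker (psi X A)) : evMap A α x ∈ LinearMap.ker (psi Y A) := by
  rw [LinearMap.mem_ker] at hx ⊢
  funext B
  refine HomModule.ext fun g => ?_
  have h : actHom X g x = 0 := DFunLike.congr_fun (congrFun hx B) g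
  change actHom Y g (evMap A α x) = 0
  rw [← evMap_act, h, map_zero]

/-- The functor `k_A : Add(𝒜, R-Mod) → R_A-Mod`. -/
def kFunctor : (𝒜 ⥤+ ModuleCat.{u} R) ⥤ ModuleCat.{u} (End A) where
  obj X := ModuleCat.of (End A) (KObj X A)
  map α := ModuleCat.ofHom ((evMap A α).restrict (ker_psi_le A α))

instance : (kFunctor (R := R) A).Additive where
  map_add := by intros; rfl

variable (X)

theorem psi_mem_ker_mu (h𝒜 : HasZeroRoundTrips 𝒜) (x : Ev A X) :
    psi X A x ∈ LinearMap.ker (mu X A) := by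
  rw [LinearMap.mem_ker]
  refine Prod.ext ?_ ?_
  · funext p
    refine HomModule.ext fun f => HomModule.ext fun g => ?_
    change actHom X g (actHom X f x) - actHom X (f ≫ g) x = 0
    rw [actHom_comp, sub_self]
  · funext B
    refine HomModule.ext fun f => HomModule.ext fun g => ?_
    change actHom X g (actHom X f x) = 0
    rw [← actHom_comp, h𝒜 B.1 A B.2 f g, actHom_zero]
    rfl

/-- The canonical sequence `k_A(X) → X(A) → ker (μ_{A,X})`, whose first homomorphism is the
inclusion and whose second one is induced by `ψ_A^X`. -/
def kSequence (h𝒜 : HasZeroRoundTrips 𝒜) : ShortComplex (ModuleCat.{u} (End A)) where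
  X₁ := ModuleCat.of (End A) (KObj X A)
  X₂ := ModuleCat.of (End A) (Ev A X)
  X₃ := ModuleCat.of (End A) (KerMu X A)
  f := ModuleCat.ofHom (LinearMap.ker (psi X A)).subtype
  g := ModuleCat.ofHom ((psi X A).codRestrict _ (psi_mem_ker_mu X A h𝒜))
  zero := by
    refine ModuleCat.hom_ext (LinearMap.ext fun x => Subtype.ext ?_)
    exact x.2

end Ker

/-! ## The subcategory of functors compatible with `R → R_A` -/

/-- For ring homomorphisms `δ_A : R → R_A`: the functors `X` for which the `R`-module `X(A)` is
the restriction along `δ_A` of the `R_A`-module `X(A)`. -/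
def IsCompatible (δ : ∀ A : 𝒜, R →+* End A) : ObjectProperty (𝒜 ⥤+ ModuleCat.{u} R) :=
  fun X => ∀ (A : 𝒜) (r : R) (x : X.obj.obj A), (X.obj.map (End.asHom (δ A r))).hom x = r • x

end

/-! An exact structure on an abelian category satisfies the obscure axiom: a short exact sequence is
distinguished as soon as its epimorphism becomes admissible after precomposition with some morphism,
and dually (`ses_of_isAdmissibleEpi_comp`, `ses_of_isAdmissibleMono_comp`). Hence split sequences
are always distinguished, and admissibility of c_A(Z) → c_A(X) can be tested on Z(A).

Let Y → Z → X be in the degreewise structure and let the canonical sequence of X be distinguished.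
Its exactness gives ker varphi = im phi for X. Since elements of im phi lift from X to Z and varphi
kills them there, a diagram chase shows that c_A keeps the sequence exact. The composite Z(A) →
c_A(Z) → c_A(X) equals Z(A) → X(A) → c_A(X), a composite of admissible epimorphisms, so the obscure
axiom applies (`ses_map_cFunctor`).

Conversely, flatness is tested on the cover F = ⨁_B Hom(B, -) ⊗ X(B) → X with kernel K. At each
object it is split by x ↦ id ⊗ x, so it is short exact for every choice of the E_B. Vanishing of the
round trips gives c_A(F) ≅ X(A), which identifies X(A) → c_A(X) with c_A(F) → c_A(X) and makes it
admissible. An element of ker varphi, seen in F(A), lies in K(A) and dies in c_A(F); as c_A(K) →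
c_A(F) is injective, it comes from varphi of K, and projecting away the summand at A sends such
elements into im phi. So coker phi → X(A) is injective (`ses_cSequence`).

For k_A the argument is dual, with the hull X → ∏_B Hom(Hom(-, B), X(B)), split at C by u ↦ u_C(id):
a family in ker mu, extended by zero at A, becomes modulo X an element of k_A of the cokernel
(`ses_map_kFunctor`, `ses_kSequence`).

The commutation rule for δ puts cover and hull in the subcategory of compatible functors, which also
contains the kernel and cokernel, so the same test sequences serve there. -/

/-! ### Kernel-cokernel pairs: abelian categories and fully faithful functors. -/

section KernelCokernelPair

variable {C : Type*} [Category C]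

theorem CategoryTheory.ShortComplex.ShortExact.isKernelCokernelPair [Preadditive C] [Balanced C]
    {S : ShortComplex C} (hS : S.ShortExact) : IsKernelCokernelPair S :=
  ⟨⟨hS.fIsKernel⟩, ⟨hS.gIsCokernel⟩⟩

theorem IsKernelCokernelPair.shortExact [Abelian C] {S : ShortComplex C}
    (hS : IsKernelCokernelPair S) : S.ShortExact where
  exact := S.exact_of_f_is_kernel hS.1.some
  mono_f := mono_of_isLimit_fork hS.1.some
  epi_g := epi_of_isColimit_cofork hS.2.some

/-- A fully faithful functor reflects kernel-cokernel pairs. -/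
theorem IsKernelCokernelPair.of_map [HasZeroMorphisms C] {D : Type*} [Category D]
    [HasZeroMorphisms D] (F : C ⥤ D) [F.PreservesZeroMorphisms] [F.Full] [F.Faithful]
    {S : ShortComplex C} (hS : IsKernelCokernelPair (S.map F)) : IsKernelCokernelPair S := by
  obtain ⟨⟨hk⟩, ⟨hc⟩⟩ := hS
  have hl {W : C} (g : W ⟶ S.X₂) (hg : g ≫ S.g = 0) :
      ∃ l : F.obj W ⟶ F.obj S.X₁, l ≫ F.map S.f = F.map g := by
    obtain ⟨l, h⟩ := KernelFork.IsLimit.lift' hk (F.map g)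
      ((F.map_comp _ _).symm.trans (by rw [hg, F.map_zero]; rfl))
    exact ⟨l, h⟩
  have hd {W : C} (g : S.X₂ ⟶ W) (hg : S.f ≫ g = 0) :
      ∃ l : F.obj S.X₃ ⟶ F.obj W, F.map S.g ≫ l = F.map g := by
    obtain ⟨l, h⟩ := CokernelCofork.IsColimit.desc' hc (F.map g)
      ((F.map_comp _ _).symm.trans (by rw [hg, F.map_zero]; rfl))
    exact ⟨l, h⟩
  choose l hl using @hl
  choose d hd using @hd
  have hl' {W : C} (g : W ⟶ S.X₂) (hg : g ≫ S.g = 0) : F.preimage (l g hg) ≫ S.f = g :=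
    F.map_injective (by rw [F.map_comp, F.map_preimage, hl])
  have hd' {W : C} (g : S.X₂ ⟶ W) (hg : S.f ≫ g = 0) : S.g ≫ F.preimage (d g hg) = g :=
    F.map_injective (by rw [F.map_comp, F.map_preimage, hd])
  refine ⟨⟨KernelFork.IsLimit.ofι _ _ (fun g hg => F.preimage (l g hg)) hl' ?_⟩,
    ⟨CokernelCofork.IsColimit.ofπ _ _ (fun g hg => F.preimage (d g hg)) hd' ?_⟩⟩
  · intro W g hg m hm
    refine F.map_injective (Fork.IsLimit.hom_ext hk ?_)
    change F.map m ≫ F.map S.f = F.map _ ≫ F.map S.f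
    rw [← F.map_comp, ← F.map_comp, hm, hl']
  · intro W g hg m hm
    refine F.map_injective (Cofork.IsColimit.hom_ext hc ?_)
    change F.map S.g ≫ F.map m = F.map S.g ≫ F.map _
    rw [← F.map_comp, ← F.map_comp, hm, hd']

end KernelCokernelPair

/-! ### Exact structures on an abelian category and the obscure axiom. -/

namespace ExactStructure

open scoped ZeroObject

variable {C : Type*} [Category C] [Abelian C] (E : ExactStructure C)

theorem shortExact {S : ShortComplex C} (hS : E.ses S) : S.ShortExact :=
  (E.isKernelCokernelPair S hS).shortExact

/-- Kernels are unique up to isomorphism and `ses` is closed under isomorphism, so only the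
epimorphism matters. -/
theorem ses_of_isAdmissibleEpi {S : ShortComplex C} (hS : S.ShortExact)
    (h : IsAdmissibleEpi E.ses S.g) : E.ses S := by
  obtain ⟨X, i, w, hi⟩ := h
  have hk := (E.isKernelCokernelPair _ hi).1.some
  refine E.of_iso ?_ hi
  refine ShortComplex.isoMk (hk.conePointUniqueUpToIso hS.fIsKernel) (Iso.refl _)
    (Iso.refl _) ?_ (by simp)
  have := hk.conePointUniqueUpToIso_hom_comp hS.fIsKernel WalkingParallelPair.zero
  simpa using this

theorem ses_of_isAdmissibleMono {S : ShortComplex C} (hS : S.ShortExact)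
    (h : IsAdmissibleMono E.ses S.f) : E.ses S := by
  obtain ⟨Z, p, w, hp⟩ := h
  have hc := (E.isKernelCokernelPair _ hp).2.some
  refine E.of_iso ?_ hp
  refine ShortComplex.isoMk (Iso.refl _) (Iso.refl _)
    (hc.coconePointUniqueUpToIso hS.gIsCokernel) (by simp) ?_
  have := hc.comp_coconePointUniqueUpToIso_hom hS.gIsCokernel WalkingParallelPair.one
  simpa using this.symm

theorem isAdmissibleEpi_of_arrow_iso {X Y X' Y' : C} {p : X ⟶ Y} {q : X' ⟶ Y'} (e : X ≅ X')
    (e' : Y ≅ Y') (h : p ≫ e'.hom = e.hom ≫ q) (hp : IsAdmissibleEpi E.ses p) :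
    IsAdmissibleEpi E.ses q := by
  obtain ⟨K, i, w, hi⟩ := hp
  have w' : (i ≫ e.hom) ≫ q = 0 := by rw [Category.assoc, ← h, reassoc_of% w, zero_comp]
  refine ⟨K, i ≫ e.hom, w', E.of_iso ?_ hi⟩
  refine ShortComplex.isoMk (Iso.refl _) e e' ?_ ?_
  · simp
  · exact h.symm

theorem isAdmissibleMono_of_arrow_iso {X Y X' Y' : C} {i : X ⟶ Y} {j : X' ⟶ Y'} (e : X ≅ X')
    (e' : Y ≅ Y') (h : i ≫ e'.hom = e.hom ≫ j) (hi : IsAdmissibleMono E.ses i) :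
    IsAdmissibleMono E.ses j := by
  obtain ⟨K, p, w, hp⟩ := hi
  have w' : j ≫ e'.inv ≫ p = 0 := by
    rw [← cancel_epi e.hom, ← reassoc_of% h, e'.hom_inv_id_assoc, w, comp_zero]
  refine ⟨K, e'.inv ≫ p, w', E.of_iso ?_ hp⟩
  refine ShortComplex.isoMk e e' (Iso.refl _) ?_ ?_
  · exact h.symm
  · simp

/-- The axiom supplies one pullback square with this property; every other one is isomorphic to it.
-/
theorem isAdmissibleEpi_of_isPullback {P X Y Z : C} {g' : P ⟶ X} {p' : P ⟶ Y} {p : X ⟶ Z}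
    {g : Y ⟶ Z} (sq : IsPullback g' p' p g) (hp : IsAdmissibleEpi E.ses p) :
    IsAdmissibleEpi E.ses p' := by
  obtain ⟨Q, a, b, sq', hb⟩ := E.pullback p g hp
  exact E.isAdmissibleEpi_of_arrow_iso (sq'.isoIsPullback _ _ sq) (Iso.refl _) (by simp) hb

theorem isAdmissibleMono_of_isPushout {X Y Z P : C} {i : X ⟶ Y} {f : X ⟶ Z} {f' : Y ⟶ P}
    {i' : Z ⟶ P} (sq : IsPushout i f f' i') (hi : IsAdmissibleMono E.ses i) :
    IsAdmissibleMono E.ses i' := by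
  obtain ⟨Q, a, b, sq', hb⟩ := E.pushout i f hi
  exact E.isAdmissibleMono_of_arrow_iso (Iso.refl _) (sq'.isoIsPushout _ _ sq) (by simp) hb

theorem isAdmissibleEpi_of_isIso {X Y : C} (f : X ⟶ Y) [IsIso f] : IsAdmissibleEpi E.ses f :=
  E.isAdmissibleEpi_of_arrow_iso (Iso.refl X) (asIso f) (by simp) (E.id_epi X)

theorem isAdmissibleMono_of_isIso {X Y : C} (f : X ⟶ Y) [IsIso f] : IsAdmissibleMono E.ses f :=
  E.isAdmissibleMono_of_arrow_iso (Iso.refl X) (asIso f) (by simp) (E.id_mono X)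

/-- The cokernel of the admissible monomorphism `𝟙 X` is a zero object. -/
theorem isAdmissibleEpi_zero (X : C) : IsAdmissibleEpi E.ses (0 : X ⟶ 0) := by
  obtain ⟨Z, p, w, hp⟩ := E.id_mono X
  have := (E.shortExact hp).epi_g
  have hZ : IsZero Z := by
    rw [IsZero.iff_id_eq_zero, ← cancel_epi p]
    have : p = 0 := by simpa using w
    simp [this]
  exact E.isAdmissibleEpi_of_arrow_iso (Iso.refl _) hZ.isoZero
    (HasZeroObject.to_zero_ext _ _) ⟨_, _, w, hp⟩

theorem isAdmissibleMono_zero (X : C) : IsAdmissibleMono E.ses (0 : 0 ⟶ X) := by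
  obtain ⟨Z, p, w, hp⟩ := E.id_epi X
  have := (E.shortExact hp).mono_f
  have hZ : IsZero Z := by
    rw [IsZero.iff_id_eq_zero, ← cancel_mono p]
    have : p = 0 := by simpa using w
    simp [this]
  exact E.isAdmissibleMono_of_arrow_iso hZ.isoZero (Iso.refl _)
    (hZ.eq_of_src _ _) ⟨_, _, w, hp⟩

theorem isAdmissibleEpi_biprod_snd (X Y : C) :
    IsAdmissibleEpi E.ses (biprod.snd : X ⊞ Y ⟶ Y) :=
  E.isAdmissibleEpi_of_isPullback (IsPullback.of_has_biproduct X Y) (E.isAdmissibleEpi_zero X)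

theorem isAdmissibleMono_biprod_inr (X Y : C) :
    IsAdmissibleMono E.ses (biprod.inr : Y ⟶ X ⊞ Y) :=
  E.isAdmissibleMono_of_isPushout (IsPushout.of_has_biproduct X Y) (E.isAdmissibleMono_zero X)

theorem isPullback_biprod_map_id (Z : C) {M W : C} (q : M ⟶ W) :
    IsPullback biprod.snd (biprod.map (𝟙 Z) q) q biprod.snd := by
  refine ⟨⟨by simp⟩, ⟨PullbackCone.IsLimit.mk _
    (fun s => biprod.lift (s.snd ≫ biprod.fst) s.fst) ?_ ?_ ?_⟩⟩
  · intro s; simp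
  · intro s
    ext
    · simp
    · simpa using s.condition
  · intro s m h h'
    ext
    · simp [← h']
    · simp [← h]

theorem isPushout_biprod_map_id (Z : C) {M W : C} (q : M ⟶ W) :
    IsPushout q biprod.inr biprod.inr (biprod.map (𝟙 Z) q) := by
  refine ⟨⟨by simp⟩, ⟨PushoutCocone.IsColimit.mk _
    (fun s => biprod.desc (biprod.inl ≫ s.inr) s.inl) ?_ ?_ ?_⟩⟩
  · intro s; simp
  · intro s
    ext
    · simp
    · simpa using s.condition
  · intro s m h h'
    ext
    · simp [← h']
    · simp [← h]

/-- This square cancels the summand `M` at the end of the obscure axiom: it recovers `i` from `i ⊕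
id`. -/
theorem isPushout_biprod_fst {K Z : C} (M : C) (i : K ⟶ Z) :
    IsPushout (biprod.map i (𝟙 M)) biprod.fst biprod.fst i := by
  refine ⟨⟨by simp⟩, ⟨PushoutCocone.IsColimit.mk _ (fun s => biprod.inl ≫ s.inl) ?_ ?_ ?_⟩⟩
  · intro s
    ext
    · simp
    · have := biprod.inr ≫= s.condition
      simp at this
      simp [this]
  · intro s
    have := biprod.inl ≫= s.condition
    simpa using this
  · intro s m h h'
    simp [← h]

theorem isPullback_biprod_inl {K Z : C} (M : C) (p : Z ⟶ K) :
    IsPullback biprod.inl p (biprod.map p (𝟙 M)) biprod.inl := by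
  refine ⟨⟨by simp⟩, ⟨PullbackCone.IsLimit.mk _ (fun s => s.fst ≫ biprod.fst) ?_ ?_ ?_⟩⟩
  · intro s
    ext
    · simp
    · have := s.condition =≫ biprod.snd
      simp at this
      simp [this]
  · intro s
    have := s.condition =≫ biprod.fst
    simpa using this
  · intro s m h h'
    simp [← h]

/-- The obscure axiom: a short exact sequence is distinguished if some composite `e ≫ S.g` is an
admissible epimorphism. -/
theorem ses_of_isAdmissibleEpi_comp {S : ShortComplex C} (hS : S.ShortExact) {M : C}
    (e : M ⟶ S.X₂) (h : IsAdmissibleEpi E.ses (e ≫ S.g)) : E.ses S := by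
  -- The goal is that `(S.g, 0)` on `S.X₂ ⊞ M` is admissible. After a shear it becomes `(S.g, e ≫
  -- S.g)`, which factors as `id ⊕ (e ≫ S.g)`, a pullback of the given admissible epimorphism,
  -- followed by `(S.g, id)`, a sheared projection.
  have h1 := E.isAdmissibleEpi_of_isPullback (isPullback_biprod_map_id S.X₂ (e ≫ S.g)) h
  have h2 : IsAdmissibleEpi E.ses (biprod.desc S.g (𝟙 S.X₃)) := by
    let θ : S.X₂ ⊞ S.X₃ ≅ S.X₂ ⊞ S.X₃ :=
      ⟨biprod.lift biprod.fst (biprod.desc S.g (𝟙 _)),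
        biprod.lift biprod.fst (biprod.desc (-S.g) (𝟙 _)), by ext <;> simp, by ext <;> simp⟩
    exact E.isAdmissibleEpi_of_arrow_iso θ.symm (Iso.refl _) (by ext <;> simp [θ])
      (E.isAdmissibleEpi_biprod_snd S.X₂ S.X₃)
  have h3 : IsAdmissibleEpi E.ses (biprod.fst ≫ S.g : S.X₂ ⊞ M ⟶ S.X₃) := by
    let θ : S.X₂ ⊞ M ≅ S.X₂ ⊞ M :=
      ⟨biprod.lift (biprod.desc (𝟙 _) e) biprod.snd,
        biprod.lift (biprod.desc (𝟙 _) (-e)) biprod.snd, by ext <;> simp, by ext <;> simp⟩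
    exact E.isAdmissibleEpi_of_arrow_iso θ (Iso.refl _) (by ext <;> simp [θ]) (E.comp_epi _ _ h1 h2)
  have := hS.mono_f
  have := hS.epi_g
  -- The kernel of `(S.g, 0)` is `S.f ⊕ id`, hence an admissible monomorphism; its pushout along the
  -- projection off `M` is `S.f`.
  let T : ShortComplex C :=
    ShortComplex.mk (biprod.map S.f (𝟙 M)) (biprod.fst ≫ S.g) (by ext <;> simp)
  have hT : T.ShortExact :=
    { exact := T.exact_of_f_is_kernel (KernelFork.IsLimit.ofι _ _
        (fun g hg => biprod.lift (hS.exact.lift (g ≫ biprod.fst) (by simpa [T] using hg))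
          (g ≫ biprod.snd))
        (fun g hg => by
          dsimp only [T]
          ext <;> simp)
        (fun g hg m hm => by
          have h1 := hm =≫ biprod.fst
          have h2 := hm =≫ biprod.snd
          simp only [T, Category.assoc, biprod.map_fst, biprod.map_snd, Category.comp_id] at h1 h2
          ext
          · rw [← cancel_mono S.f]
            simp [h1]
          · simp [h2]))
      mono_f := by dsimp [T]; infer_instance
      epi_g := by dsimp [T]; infer_instance }
  exact E.ses_of_isAdmissibleMono hS (E.isAdmissibleMono_of_isPushout (isPushout_biprod_fst M S.f)
    ⟨_, _, T.zero, E.ses_of_isAdmissibleEpi hT h3⟩)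

/-- The dual obscure axiom: a short exact sequence is distinguished if some composite `S.f ≫ j` is
an admissible monomorphism. -/
theorem ses_of_isAdmissibleMono_comp {S : ShortComplex C} (hS : S.ShortExact) {M : C}
    (j : S.X₂ ⟶ M) (h : IsAdmissibleMono E.ses (S.f ≫ j)) : E.ses S := by
  -- Dually, `(S.f, 0)` into `S.X₂ ⊞ M` is, up to a shear, `(S.f, id)` followed by `id ⊕ (S.f ≫ j)`.
  have h1 := E.isAdmissibleMono_of_isPushout (isPushout_biprod_map_id S.X₂ (S.f ≫ j)) h
  have h2 : IsAdmissibleMono E.ses (biprod.lift S.f (𝟙 S.X₁)) := by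
    let θ : S.X₂ ⊞ S.X₁ ≅ S.X₂ ⊞ S.X₁ :=
      ⟨biprod.desc biprod.inl (biprod.lift S.f (𝟙 _)),
        biprod.desc biprod.inl (biprod.lift (-S.f) (𝟙 _)), by ext <;> simp, by ext <;> simp⟩
    exact E.isAdmissibleMono_of_arrow_iso (Iso.refl _) θ (by ext <;> simp [θ])
      (E.isAdmissibleMono_biprod_inr S.X₂ S.X₁)
  have h3 : IsAdmissibleMono E.ses (S.f ≫ biprod.inl : S.X₁ ⟶ S.X₂ ⊞ M) := by
    let θ : S.X₂ ⊞ M ≅ S.X₂ ⊞ M :=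
      ⟨biprod.desc (biprod.lift (𝟙 _) (-j)) biprod.inr,
        biprod.desc (biprod.lift (𝟙 _) j) biprod.inr, by ext <;> simp, by ext <;> simp⟩
    exact E.isAdmissibleMono_of_arrow_iso (Iso.refl _) θ
      (by rw [show biprod.lift S.f (𝟙 S.X₁) ≫ biprod.map (𝟙 S.X₂) (S.f ≫ j) =
            biprod.lift S.f (S.f ≫ j) by ext <;> simp]
          ext <;> simp [θ])
      (E.comp_mono _ _ h2 h1)
  have := hS.mono_f
  have := hS.epi_g
  let T : ShortComplex C :=
    ShortComplex.mk (S.f ≫ biprod.inl) (biprod.map S.g (𝟙 M)) (by ext <;> simp)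
  have hT : T.ShortExact :=
    { exact := T.exact_of_g_is_cokernel (CokernelCofork.IsColimit.ofπ _ _
        (fun g hg => biprod.desc (hS.exact.desc (biprod.inl ≫ g) (by simpa [T] using hg))
          (biprod.inr ≫ g))
        (fun g hg => by
          dsimp only [T]
          ext <;> simp)
        (fun g hg m hm => by
          have h1 := biprod.inl ≫= hm
          have h2 := biprod.inr ≫= hm
          simp only [T, biprod.inl_map_assoc, biprod.inr_map_assoc, Category.id_comp] at h1 h2
          ext
          · rw [← cancel_epi S.g]
            simp [h1]
          · simp [h2]))
      mono_f := by dsimp [T]; infer_instance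
      epi_g := by dsimp [T]; infer_instance }
  exact E.ses_of_isAdmissibleEpi hS (E.isAdmissibleEpi_of_isPullback (isPullback_biprod_inl M S.g)
    ⟨_, _, T.zero, E.ses_of_isAdmissibleMono hT h3⟩)

end ExactStructure

theorem moduleCat_shortExact {S : Type*} [Ring S] {T : ShortComplex (ModuleCat.{u} S)}
    (hf : Function.Injective T.f.hom) (hfg : Function.Exact T.f.hom T.g.hom)
    (hg : Function.Surjective T.g.hom) : T.ShortExact where
  exact := (ShortComplex.ShortExact.moduleCat_exact_iff_function_exact T).2 hfg
  mono_f := (ModuleCat.mono_iff_injective _).2 hf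
  epi_g := (ModuleCat.epi_iff_surjective _).2 hg

/-! ### Objectwise exactness, kernels and cokernels of additive functors. -/

noncomputable section

section Pointwise

variable {R : Type u} [Ring R] {𝒜 : Type u} [SmallCategory 𝒜] [Preadditive 𝒜]

/-- A sequence of additive functors which is short exact at every object is a kernel-cokernel
pair. -/
theorem isKernelCokernelPair_of_evMap {X Y Z : 𝒜 ⥤+ ModuleCat.{u} R} (i : X ⟶ Y) (p : Y ⟶ Z)
    (w : i ≫ p = 0)
    (hi : ∀ C, Function.Injective (evMap C i)) (hip : ∀ C, Function.Exact (evMap C i) (evMap C p))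
    (hp : ∀ C, Function.Surjective (evMap C p)) :
    IsKernelCokernelPair (ShortComplex.mk i p w) := by
  -- The claim is reflected from the abelian category of all functors, where homology is computed
  -- objectwise.
  refine IsKernelCokernelPair.of_map (AdditiveFunctor.forget 𝒜 (ModuleCat.{u} R)) ?_
  set S := (ShortComplex.mk i p w).map (AdditiveFunctor.forget 𝒜 (ModuleCat.{u} R))
  have hS (C : 𝒜) : (S.map ((evaluation 𝒜 (ModuleCat.{u} R)).obj C)).ShortExact :=
    moduleCat_shortExact (hi C) (hip C) (hp C)
  refine ShortComplex.ShortExact.isKernelCokernelPair ?_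
  refine { exact := ?_, mono_f := ?_, epi_g := ?_ }
  · rw [ShortComplex.exact_iff_isZero_homology]
    refine Functor.isZero _ fun C => ?_
    exact ((ShortComplex.exact_iff_isZero_homology _).1 (hS C).exact).of_iso
      (S.mapHomologyIso ((evaluation 𝒜 (ModuleCat.{u} R)).obj C)).symm
  · rw [NatTrans.mono_iff_mono_app]
    exact fun C => (hS C).mono_f
  · rw [NatTrans.epi_iff_epi_app]
    exact fun C => (hS C).epi_g

/-- An additive functor, given by modules, linear maps and elementwise laws. -/
def additiveFunctorMk (obj : 𝒜 → Type u) [∀ C, AddCommGroup (obj C)] [∀ C, Module R (obj C)]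
    (map : ∀ {C D : 𝒜}, (C ⟶ D) → (obj C →ₗ[R] obj D))
    (map_id : ∀ C x, map (𝟙 C) x = x)
    (map_comp : ∀ {C D D' : 𝒜} (f : C ⟶ D) (g : D ⟶ D') x, map (f ≫ g) x = map g (map f x))
    (map_add : ∀ {C D : 𝒜} (f g : C ⟶ D) x, map (f + g) x = map f x + map g x) :
    𝒜 ⥤+ ModuleCat.{u} R where
  obj :=
    { obj := fun C => ModuleCat.of R (obj C)
      map := fun f => ModuleCat.ofHom (map f)
      map_id := fun C => ModuleCat.hom_ext (LinearMap.ext (map_id C))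
      map_comp := fun f g => ModuleCat.hom_ext (LinearMap.ext (map_comp f g)) }
  property := by
    rw [additiveFunctor_iff]
    exact { map_add := fun {C D f g} => ModuleCat.hom_ext (LinearMap.ext (map_add f g)) }

/-- The kernel of a morphism of additive functors, computed objectwise. -/
def kernelFunctor {Y Z : 𝒜 ⥤+ ModuleCat.{u} R} (p : Y ⟶ Z) : 𝒜 ⥤+ ModuleCat.{u} R :=
  additiveFunctorMk (fun C => LinearMap.ker (p.hom.app C).hom)
    (fun {C D} f => (Y.obj.map f).hom.restrict fun y hy => by
      have h := evMap_act p f y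
      rw [LinearMap.mem_ker] at hy ⊢
      exact h.trans ((congrArg (actHom Z f) hy).trans (map_zero _)))
    (fun C y => Subtype.ext (actHom_id Y C y.1))
    (fun f g y => Subtype.ext (actHom_comp Y f g y.1))
    (fun f g y => Subtype.ext (DFunLike.congr_fun (actHom_add Y f g) y.1))

/-- The cokernel of a morphism of additive functors, computed objectwise. -/
def cokernelFunctor {X Y : 𝒜 ⥤+ ModuleCat.{u} R} (i : X ⟶ Y) : 𝒜 ⥤+ ModuleCat.{u} R :=
  additiveFunctorMk (fun C => Y.obj.obj C ⧸ LinearMap.range (i.hom.app C).hom)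
    (fun {C D} f => Submodule.mapQ _ _ (Y.obj.map f).hom (by
        rintro _ ⟨x, rfl⟩
        exact ⟨actHom X f x, evMap_act i f x⟩))
    (fun C y => by
      obtain ⟨y, rfl⟩ := Submodule.mkQ_surjective _ y
      exact congrArg (Submodule.mkQ _) (actHom_id Y C y))
    (fun f g y => by
      obtain ⟨y, rfl⟩ := Submodule.mkQ_surjective _ y
      exact congrArg (Submodule.mkQ _) (actHom_comp Y f g y))
    (fun f g y => by
      obtain ⟨y, rfl⟩ := Submodule.mkQ_surjective _ y
      exact congrArg (Submodule.mkQ _) (DFunLike.congr_fun (actHom_add Y f g) y))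

/-- The inclusion of the kernel. -/
def kernelι {Y Z : 𝒜 ⥤+ ModuleCat.{u} R} (p : Y ⟶ Z) : kernelFunctor p ⟶ Y :=
  ⟨{ app := fun C => ModuleCat.ofHom (LinearMap.ker (p.hom.app C).hom).subtype
     naturality := fun _ _ _ => rfl }⟩

/-- The projection to the cokernel. -/
def cokernelπ {X Y : 𝒜 ⥤+ ModuleCat.{u} R} (i : X ⟶ Y) : Y ⟶ cokernelFunctor i :=
  ⟨{ app := fun C => ModuleCat.ofHom (LinearMap.range (i.hom.app C).hom).mkQ
     naturality := fun _ _ _ => rfl }⟩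

theorem kernelι_comp {Y Z : 𝒜 ⥤+ ModuleCat.{u} R} (p : Y ⟶ Z) : kernelι p ≫ p = 0 := by
  ext C y
  exact y.2

theorem comp_cokernelπ {X Y : 𝒜 ⥤+ ModuleCat.{u} R} (i : X ⟶ Y) : i ≫ cokernelπ i = 0 := by
  ext C x
  exact (Submodule.Quotient.mk_eq_zero _).2 ⟨x, rfl⟩

theorem evMap_kernelι_injective {Y Z : 𝒜 ⥤+ ModuleCat.{u} R} (p : Y ⟶ Z) (C : 𝒜) :
    Function.Injective (evMap C (kernelι p)) :=
  Subtype.val_injective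

theorem evMap_kernelι_exact {Y Z : 𝒜 ⥤+ ModuleCat.{u} R} (p : Y ⟶ Z) (C : 𝒜) :
    Function.Exact (evMap C (kernelι p)) (evMap C p) :=
  fun y => ⟨fun h => ⟨⟨y, h⟩, rfl⟩, by rintro ⟨y, rfl⟩; exact y.2⟩

theorem evMap_cokernelπ_surjective {X Y : 𝒜 ⥤+ ModuleCat.{u} R} (i : X ⟶ Y) (C : 𝒜) :
    Function.Surjective (evMap C (cokernelπ i)) :=
  Submodule.mkQ_surjective (LinearMap.range (i.hom.app C).hom)

theorem evMap_cokernelπ_exact {X Y : 𝒜 ⥤+ ModuleCat.{u} R} (i : X ⟶ Y) (C : 𝒜) :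
    Function.Exact (evMap C i) (evMap C (cokernelπ i)) :=
  fun _ => Submodule.Quotient.mk_eq_zero (LinearMap.range (i.hom.app C).hom)

theorem isCompatible_kernelFunctor {δ : ∀ A : 𝒜, R →+* End A} {Y Z : 𝒜 ⥤+ ModuleCat.{u} R}
    (p : Y ⟶ Z) (hY : IsCompatible δ Y) : IsCompatible δ (kernelFunctor p) :=
  fun C r y => Subtype.ext (hY C r y.1)

theorem isCompatible_cokernelFunctor {δ : ∀ A : 𝒜, R →+* End A} {X Y : 𝒜 ⥤+ ModuleCat.{u} R}
    (i : X ⟶ Y) (hY : IsCompatible δ Y) : IsCompatible δ (cokernelFunctor i) := by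
  intro C r y
  obtain ⟨y, rfl⟩ := evMap_cokernelπ_surjective i C y
  exact congrArg (LinearMap.range (i.hom.app C).hom).mkQ (hY C r y)

end Pointwise
end

/-! ### Right exactness of the tensor product, and generators of the image of `phi`. -/

noncomputable section

theorem DirectSum.lmap_exact {S : Type*} [Ring S] {ι : Type*} {L M N : ι → Type*}
    [∀ i, AddCommGroup (L i)] [∀ i, AddCommGroup (M i)] [∀ i, AddCommGroup (N i)]
    [∀ i, Module S (L i)] [∀ i, Module S (M i)] [∀ i, Module S (N i)]
    (f : ∀ i, L i →ₗ[S] M i) (g : ∀ i, M i →ₗ[S] N i) (h : ∀ i, Function.Exact (f i) (g i)) :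
    Function.Exact (DirectSum.lmap f) (DirectSum.lmap g) := by
  rw [LinearMap.exact_iff, DirectSum.ker_lmap, DirectSum.range_lmap]
  simp_rw [fun i => (LinearMap.exact_iff).1 (h i)]

section HomTensor

variable {𝒜 : Type u} [SmallCategory 𝒜] [Preadditive 𝒜] {B : 𝒜} (A : 𝒜)
  {L M N : Type u} [AddCommGroup L] [AddCommGroup M] [AddCommGroup N]
  [Module (End B) L] [Module (End B) M] [Module (End B) N]

theorem HomTensor.map_surjective {p : M →ₗ[End B] N} (hp : Function.Surjective p) :
    Function.Surjective (HomTensor.map A p) := by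
  intro z
  induction z using HomTensor.induction with
  | zero => exact ⟨0, map_zero _⟩
  | tmul g y =>
    obtain ⟨y, rfl⟩ := hp y
    exact ⟨HomTensor.tmul g y, rfl⟩
  | add a b ha hb =>
    obtain ⟨a, rfl⟩ := ha
    obtain ⟨b, rfl⟩ := hb
    exact ⟨a + b, map_add _ _ _⟩

/-- Right exactness, proved by a map from `Hom(B, A) ⊗ N` back to the cokernel of `id ⊗ i`. It sends
`g ⊗ n` to the class of `g ⊗ m` for any `m` over `n`. -/
theorem HomTensor.map_exact {i : L →ₗ[End B] M} {p : M →ₗ[End B] N} (h : Function.Exact i p)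
    (hp : Function.Surjective p) : Function.Exact (HomTensor.map A i) (HomTensor.map A p) := by
  let Q := HomTensor B A M ⧸ LinearMap.range (HomTensor.map A i)
  let π := (LinearMap.range (HomTensor.map A i)).mkQ
  have key (g : B ⟶ A) {m m' : M} (hm : p m = p m') :
      π (HomTensor.tmul g m) = π (HomTensor.tmul g m') := by
    obtain ⟨l, hl⟩ := (h (m - m')).1 (by rw [map_sub, hm, sub_self])
    rw [← sub_eq_zero, ← map_sub]
    refine (Submodule.Quotient.mk_eq_zero _).2 ⟨HomTensor.tmul g l, ?_⟩
    rw [HomTensor.map_tmul, hl, ← HomTensor.tmulBi_apply, map_sub]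
    rfl
  -- The section `s` is only a map of sets; `key` makes the expressions below additive and balanced.
  choose s hs using hp
  let b : (B ⟶ A) →+ N →+ Q :=
    AddMonoidHom.mk' (fun g => AddMonoidHom.mk' (fun n => π (HomTensor.tmul g (s n)))
      (fun n n' => by
        rw [← map_add, ← HomTensor.tmul_add]
        exact key g (by simp [hs])))
      (fun g g' => by
        ext n
        change π _ = π _ + π _
        rw [HomTensor.add_tmul, map_add])
  let q : HomTensor B A N →+ Q := HomTensor.liftAdd b (fun t g n => by
    change π _ = π _
    rw [← HomTensor.tmul_smul]
    exact key g (by simp [hs]))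
  have hq (z : HomTensor B A M) : q (HomTensor.map A p z) = π z := by
    induction z using HomTensor.induction with
    | zero => simp
    | tmul g y => exact key g (hs _)
    | add a b ha hb => rw [map_add, map_add, map_add, ha, hb]
  intro z
  constructor
  · intro hz
    have := hq z
    rw [hz, map_zero] at this
    exact (Submodule.Quotient.mk_eq_zero _).1 this.symm
  · rintro ⟨z, rfl⟩
    induction z using HomTensor.induction with
    | zero => simp
    | tmul g y => rw [HomTensor.map_tmul, HomTensor.map_tmul, h.apply_apply_eq_zero,
        ← HomTensor.tmulBi_apply, map_zero]
    | add a b ha hb => rw [map_add, map_add, ha, hb, add_zero]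

end HomTensor

section TensorSum

variable {R : Type u} [Ring R] {𝒜 : Type u} [SmallCategory 𝒜] [Preadditive 𝒜]
variable (X : 𝒜 ⥤+ ModuleCat.{u} R) {A : 𝒜}

open Classical in
/-- The element `g ⊗ x` of `⨁_{B ≠ A} Hom(B, A) ⊗_{R_B} X(B)`. -/
def TensorSum.single (B : {B : 𝒜 // B ≠ A}) (g : B.1 ⟶ A) (x : Ev B.1 X) : TensorSum X A :=
  DirectSum.lof (End A) _ (fun B : {B : 𝒜 // B ≠ A} => HomTensor B.1 A (Ev B.1 X)) B
    (HomTensor.tmul g x)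

variable {X}

theorem TensorSum.single_add (B : {B : 𝒜 // B ≠ A}) (g : B.1 ⟶ A) (x y : Ev B.1 X) :
    TensorSum.single X B g (x + y) = TensorSum.single X B g x + TensorSum.single X B g y := by
  rw [TensorSum.single, HomTensor.tmul_add, map_add]
  rfl

theorem TensorSum.single_zero (B : {B : 𝒜 // B ≠ A}) (g : B.1 ⟶ A) :
    TensorSum.single X B g (0 : Ev B.1 X) = 0 := by
  simpa using TensorSum.single_add B g (0 : Ev B.1 X) 0

theorem TensorSum.induction {P : TensorSum X A → Prop} (zero : P 0)
    (single : ∀ B g x, P (TensorSum.single X B g x)) (add : ∀ a b, P a → P b → P (a + b))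
    (t : TensorSum X A) : P t := by
  classical
  induction t using DirectSum.induction_on with
  | zero => exact zero
  | add a b ha hb => exact add _ _ ha hb
  | of B z =>
    induction z using HomTensor.induction with
    | zero => simpa using zero
    | tmul g x => exact single B g x
    | add a b ha hb => rw [map_add]; exact add _ _ ha hb

@[simp] theorem varphi_single (B : {B : 𝒜 // B ≠ A}) (g : B.1 ⟶ A) (x : Ev B.1 X) :
    varphi X A (TensorSum.single X B g x) = actHom X g x := by
  classical
  rw [varphi, TensorSum.single, DirectSum.toModule_lof, tensorAct_tmul]

variable (A) in
/-- The map `⨁_{B ≠ A} Hom(B, A) ⊗_{R_B} X(B) → ⨁_{B ≠ A} Hom(B, A) ⊗_{R_B} Y(B)` induced by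
`X ⟶ Y`. -/
def TensorSum.map {Y : 𝒜 ⥤+ ModuleCat.{u} R} (α : X ⟶ Y) : TensorSum X A →ₗ[End A] TensorSum Y A :=
  DirectSum.lmap fun B => HomTensor.map A (evMap B.1 α)

@[simp] theorem TensorSum.map_single {Y : 𝒜 ⥤+ ModuleCat.{u} R} (α : X ⟶ Y)
    (B : {B : 𝒜 // B ≠ A}) (g : B.1 ⟶ A) (x : Ev B.1 X) :
    TensorSum.map A α (TensorSum.single X B g x) = TensorSum.single Y B g (evMap B.1 α x) := by
  classical
  rw [TensorSum.map, TensorSum.single, DirectSum.lmap_lof]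
  rfl

theorem varphi_map {Y : 𝒜 ⥤+ ModuleCat.{u} R} (α : X ⟶ Y) (t : TensorSum X A) :
    varphi Y A (TensorSum.map A α t) = evMap A α (varphi X A t) := by
  induction t using TensorSum.induction with
  | zero => simp
  | single B g x => simp [evMap_act]
  | add a b ha hb => simp only [map_add, ha, hb]

theorem single_sub_single_mem_range_phi (B B' : {B : 𝒜 // B ≠ A}) (f : B.1 ⟶ B'.1)
    (g : B'.1 ⟶ A) (x : Ev B.1 X) :
    TensorSum.single X B' g (actHom X f x) - TensorSum.single X B (f ≫ g) x ∈
      LinearMap.range (phi X A) := by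
  classical
  refine ⟨(DirectSum.lof (End A) _ (fun p : {B : 𝒜 // B ≠ A} × {B : 𝒜 // B ≠ A} =>
    HomTensor p.2.1 A (HomTensor p.1.1 p.2.1 (Ev p.1.1 X))) (B, B')
    (HomTensor.tmul g (HomTensor.tmul f x)), 0), ?_⟩
  rw [phi, LinearMap.coprod_apply, map_zero, add_zero, LinearMap.sub_apply, h₁, h₂,
    DirectSum.toModule_lof, DirectSum.toModule_lof]
  rfl

theorem single_actHom_mem_range_phi (B : {B : 𝒜 // B ≠ A}) (f : A ⟶ B.1)
    (g : B.1 ⟶ A) (x : Ev A X) :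
    TensorSum.single X B g (actHom X f x) ∈ LinearMap.range (phi X A) := by
  classical
  refine ⟨(0, DirectSum.lof (End A) _ (fun B : {B : 𝒜 // B ≠ A} =>
    HomTensor B.1 A (HomTensor A B.1 (Ev A X))) B
    (HomTensor.tmul g (HomTensor.tmul f x))), ?_⟩
  rw [phi, LinearMap.coprod_apply, map_zero, zero_add, nu, DirectSum.toModule_lof]
  rfl

/-- The domain of `phi` is spanned by iterated pure tensors, so the two families of relations
generate its image. -/
theorem range_phi_le_of {P : Submodule (End A) (TensorSum X A)}
    (h : ∀ (B B' : {B : 𝒜 // B ≠ A}) (f : B.1 ⟶ B'.1) (g : B'.1 ⟶ A) (x : Ev B.1 X),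
      TensorSum.single X B' g (actHom X f x) - TensorSum.single X B (f ≫ g) x ∈ P)
    (h' : ∀ (B : {B : 𝒜 // B ≠ A}) (f : A ⟶ B.1) (g : B.1 ⟶ A) (x : Ev A X),
      TensorSum.single X B g (actHom X f x) ∈ P) :
    LinearMap.range (phi X A) ≤ P := by
  classical
  rintro _ ⟨⟨z, w⟩, rfl⟩
  rw [phi, LinearMap.coprod_apply]
  refine add_mem ?_ ?_
  · induction z using DirectSum.induction_on with
    | zero => simp
    | add a b ha hb => rw [map_add]; exact add_mem ha hb
    | of p z =>
      induction z using HomTensor.induction with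
      | zero => simp
      | add a b ha hb => rw [map_add, map_add]; exact add_mem ha hb
      | tmul g z =>
        induction z using HomTensor.induction with
        | zero => rw [← HomTensor.tmulBi_apply, map_zero, map_zero, map_zero]; exact zero_mem _
        | add a b ha hb => rw [HomTensor.tmul_add, map_add, map_add]; exact add_mem ha hb
        | tmul f x =>
          refine Eq.subst (motive := (· ∈ P)) ?_ (h p.1 p.2 f g x)
          change _ = h₁ X A (DirectSum.lof (End A) _ _ p _) -
            h₂ X A (DirectSum.lof (End A) _ _ p _)
          rw [h₁, h₂, DirectSum.toModule_lof, DirectSum.toModule_lof]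
          rfl
  · induction w using DirectSum.induction_on with
    | zero => simp
    | add a b ha hb => rw [map_add]; exact add_mem ha hb
    | of B z =>
      induction z using HomTensor.induction with
      | zero => simp
      | add a b ha hb => rw [map_add, map_add]; exact add_mem ha hb
      | tmul g z =>
        induction z using HomTensor.induction with
        | zero => rw [← HomTensor.tmulBi_apply, map_zero, map_zero, map_zero]; exact zero_mem _
        | add a b ha hb => rw [HomTensor.tmul_add, map_add, map_add]; exact add_mem ha hb
        | tmul f x =>
          refine Eq.subst (motive := (· ∈ P)) ?_ (h' B f g x)
          change _ = nu X A (DirectSum.lof (End A) _ _ B _)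
          rw [nu, DirectSum.toModule_lof]
          rfl

/-- Each generating relation involves one element of some `Y(B)` or of `Y(A)`; lifting that element
lifts the relation. -/
theorem range_phi_le_map {Y : 𝒜 ⥤+ ModuleCat.{u} R} (α : X ⟶ Y)
    (hα : ∀ C, Function.Surjective (evMap C α)) :
    LinearMap.range (phi Y A) ≤ (LinearMap.range (phi X A)).map (TensorSum.map A α) := by
  refine range_phi_le_of (fun B B' f g y => ?_) (fun B f g y => ?_)
  · obtain ⟨x, rfl⟩ := hα _ y
    exact ⟨_, single_sub_single_mem_range_phi B B' f g x, by simp [evMap_act]⟩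
  · obtain ⟨x, rfl⟩ := hα _ y
    exact ⟨_, single_actHom_mem_range_phi B f g x, by simp [evMap_act]⟩

end TensorSum

/-! ### Exactness of the canonical sequence implies flatness and coflatness. -/

section Flat

variable {R : Type u} [Ring R] {𝒜 : Type u} [SmallCategory 𝒜] [Preadditive 𝒜]

theorem moduleCat_injective_f {S : Type*} [Ring S] {T : ShortComplex (ModuleCat.{u} S)}
    (hT : T.ShortExact) : Function.Injective T.f.hom := hT.moduleCat_injective_f

theorem moduleCat_surjective_g {S : Type*} [Ring S] {T : ShortComplex (ModuleCat.{u} S)}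
    (hT : T.ShortExact) : Function.Surjective T.g.hom := hT.moduleCat_surjective_g

theorem moduleCat_exact {S : Type*} [Ring S] {T : ShortComplex (ModuleCat.{u} S)}
    (hT : T.ShortExact) : Function.Exact T.f.hom T.g.hom :=
  (ShortComplex.ShortExact.moduleCat_exact_iff_function_exact T).1 hT.exact

/-- If the canonical sequence of `X` is short exact, then `c_A` preserves the short exact sequences
ending with `X`. -/
theorem ses_map_cFunctor (h𝒜 : HasZeroRoundTrips 𝒜)
    (E : ∀ A : 𝒜, ExactStructure (ModuleCat.{u} (End A))) (A : 𝒜) {X Y Z : 𝒜 ⥤+ ModuleCat.{u} R}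
    (i : Y ⟶ Z) (p : Z ⟶ X) (w : i ≫ p = 0)
    (h : ∀ B, (E B).ses ((ShortComplex.mk i p w).map (ev B)))
    (hX : (E A).ses (cSequence X A h𝒜)) :
    (E A).ses ((ShortComplex.mk i p w).map (cFunctor A)) := by
  have hi (B : 𝒜) : Function.Injective (evMap B i) :=
    moduleCat_injective_f ((E B).shortExact (h B))
  have hip (B : 𝒜) : Function.Exact (evMap B i) (evMap B p) :=
    moduleCat_exact ((E B).shortExact (h B))
  have hp (B : 𝒜) : Function.Surjective (evMap B p) :=
    moduleCat_surjective_g ((E B).shortExact (h B))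
  have hφ (t : TensorSum X A) (ht : varphi X A t = 0) : t ∈ LinearMap.range (phi X A) := by
    have := (E A).shortExact hX
    have h1 : (LinearMap.range (phi X A)).liftQ (varphi X A) (range_phi_le X A h𝒜)
      (Submodule.Quotient.mk t) = 0 := ht
    exact (Submodule.Quotient.mk_eq_zero _).1
      ((injective_iff_map_eq_zero _).1 (moduleCat_injective_f this) _ h1)
  have hTs : Function.Surjective (TensorSum.map A p) :=
    (DirectSum.lmap_surjective _).2 fun B => HomTensor.map_surjective A (hp B.1)
  have hTe : Function.Exact (TensorSum.map A i) (TensorSum.map A p) :=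
    DirectSum.lmap_exact _ _ fun B => HomTensor.map_exact A (hip B.1) (hp B.1)
  refine (E A).ses_of_isAdmissibleEpi_comp ?_
    (ModuleCat.ofHom (LinearMap.range (varphi Z A)).mkQ) ?_
  · refine moduleCat_shortExact ?_ ?_ ?_
    · refine (injective_iff_map_eq_zero _).2 fun y hy => ?_
      obtain ⟨y, rfl⟩ := Submodule.mkQ_surjective (LinearMap.range (varphi Y A)) y
      obtain ⟨t, ht⟩ : evMap A i y ∈ LinearMap.range (varphi Z A) :=
        (Submodule.Quotient.mk_eq_zero _).1 hy
      -- The element `t` is corrected by `s` in the image of `phi` for `Z`, on which `varphi`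
      -- vanishes. So `t - s` has the same value under `varphi` as `t`, but comes from `Y`.
      obtain ⟨s, hs, hst⟩ := range_phi_le_map p hp (hφ (TensorSum.map A p t) (by
        rw [varphi_map, ht, (hip A).apply_apply_eq_zero]))
      obtain ⟨r, hr⟩ := (hTe (t - s)).1 (by rw [map_sub, hst, sub_self])
      refine (Submodule.Quotient.mk_eq_zero _).2 ⟨r, hi A ?_⟩
      rw [← varphi_map, hr, map_sub, ht, LinearMap.mem_ker.1 (range_phi_le Z A h𝒜 hs), sub_zero]
    · intro z
      obtain ⟨z, rfl⟩ := Submodule.mkQ_surjective (LinearMap.range (varphi Z A)) z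
      constructor
      · intro hz
        obtain ⟨t, ht⟩ : evMap A p z ∈ LinearMap.range (varphi X A) :=
          (Submodule.Quotient.mk_eq_zero _).1 hz
        obtain ⟨t, rfl⟩ := hTs t
        obtain ⟨y, hy⟩ := (hip A (z - varphi Z A t)).1 (by
          rw [map_sub, ← varphi_map, ht, sub_self])
        refine ⟨Submodule.Quotient.mk y, ?_⟩
        change Submodule.Quotient.mk (evMap A i y) = Submodule.Quotient.mk z
        rw [Submodule.Quotient.eq, hy, sub_sub_cancel_left]
        exact neg_mem ⟨t, rfl⟩
      · rintro ⟨y, hy⟩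
        obtain ⟨y, rfl⟩ := Submodule.mkQ_surjective (LinearMap.range (varphi Y A)) y
        rw [← hy]
        change Submodule.Quotient.mk (evMap A p (evMap A i y)) = 0
        rw [(hip A).apply_apply_eq_zero, Submodule.Quotient.mk_zero]
    · intro x
      obtain ⟨x, rfl⟩ := Submodule.mkQ_surjective (LinearMap.range (varphi X A)) x
      obtain ⟨z, rfl⟩ := hp A x
      exact ⟨Submodule.Quotient.mk z, rfl⟩
  -- Z(A) → c_A(Z) → c_A(X) is definitionally Z(A) → X(A) → c_A(X).
  · exact (E A).comp_epi (ModuleCat.ofHom (evMap A p)) (cSequence X A h𝒜).g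
      ⟨_, _, _, h A⟩ ⟨_, _, _, hX⟩

/-- If the canonical sequence of `X` is short exact, then `k_A` preserves the short exact sequences
beginning with `X`. -/
theorem ses_map_kFunctor (h𝒜 : HasZeroRoundTrips 𝒜)
    (E : ∀ A : 𝒜, ExactStructure (ModuleCat.{u} (End A))) (A : 𝒜) {X Y Z : 𝒜 ⥤+ ModuleCat.{u} R}
    (i : X ⟶ Y) (p : Y ⟶ Z) (w : i ≫ p = 0)
    (h : ∀ B, (E B).ses ((ShortComplex.mk i p w).map (ev B)))
    (hX : (E A).ses (kSequence X A h𝒜)) :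
    (E A).ses ((ShortComplex.mk i p w).map (kFunctor A)) := by
  have hi (B : 𝒜) : Function.Injective (evMap B i) :=
    moduleCat_injective_f ((E B).shortExact (h B))
  have hip (B : 𝒜) : Function.Exact (evMap B i) (evMap B p) :=
    moduleCat_exact ((E B).shortExact (h B))
  have hp (B : 𝒜) : Function.Surjective (evMap B p) :=
    moduleCat_surjective_g ((E B).shortExact (h B))
  refine (E A).ses_of_isAdmissibleMono_comp ?_
    (ModuleCat.ofHom (LinearMap.ker (psi Y A)).subtype) ?_
  · refine moduleCat_shortExact ?_ ?_ ?_
    · intro x x' hxx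
      exact Subtype.ext (hi A (congrArg Subtype.val hxx))
    · intro y
      constructor
      · intro hy
        obtain ⟨x, hx⟩ := (hip A y.1).1 (congrArg Subtype.val hy)
        refine ⟨⟨x, LinearMap.mem_ker.2 (funext fun B => HomModule.ext fun g => ?_)⟩,
          Subtype.ext hx⟩
        refine hi B.1 ?_
        change evMap B.1 i (actHom X g x) = evMap B.1 i 0
        rw [map_zero, evMap_act, hx]
        exact DFunLike.congr_fun (congrFun (LinearMap.mem_ker.1 y.2) B) g
      · rintro ⟨x, rfl⟩
        exact Subtype.ext ((hip A).apply_apply_eq_zero x.1)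
    · intro z
      obtain ⟨y, hy⟩ := hp A z.1
      have hz (B : {B : 𝒜 // B ≠ A}) (g : A ⟶ B.1) : actHom Z g z.1 = 0 :=
        DFunLike.congr_fun (congrFun (LinearMap.mem_ker.1 z.2) B) g
      -- A lift `y` of `z` need not lie in k_A(Y), but each `Y(g)(y)` dies in `Z(B)` and so comes
      -- from `X(B)`. These preimages form a family in ker mu. Surjectivity of X(A) → ker mu then
      -- yields an `x` whose image corrects `y`.
      have hu (B : {B : 𝒜 // B ≠ A}) (g : A ⟶ B.1) : ∃ x, evMap B.1 i x = actHom Y g y :=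
        (hip B.1 _).1 (by rw [evMap_act, hy, hz])
      choose u hu using hu
      let v : HomProd X A := fun B =>
        ({ toFun := u B
           map_add' := fun g g' => hi B.1 (by rw [map_add, hu, hu, hu, actHom_add]; rfl)
           map_smul' := fun t g => hi B.1 (by
             rw [map_smul, hu, hu]
             exact actHom_comp Y g t y) } : (A ⟶ B.1) →ₗ[End B.1] Ev B.1 X)
      have hv (B : {B : 𝒜 // B ≠ A}) (g : A ⟶ B.1) : evMap B.1 i (v B g) = actHom Y g y := hu B g
      have hvm : v ∈ LinearMap.ker (mu X A) := by
        refine LinearMap.mem_ker.2 (Prod.ext (funext fun q => HomModule.ext fun f =>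
          HomModule.ext fun g => ?_) (funext fun B => HomModule.ext fun f =>
          HomModule.ext fun g => ?_))
        · change actHom X g (v q.1 f) - v q.2 (f ≫ g) = 0
          refine sub_eq_zero.2 (hi _ ?_)
          rw [evMap_act, hv, hv, actHom_comp]
        · change actHom X g (v B f) = 0
          refine hi _ ?_
          rw [evMap_act, hv, ← actHom_comp, h𝒜 B.1 A B.2 f g, actHom_zero, map_zero]
          rfl
      obtain ⟨x, hx⟩ : ∃ x : Ev A X, (psi X A).codRestrict _ (psi_mem_ker_mu X A h𝒜) x = ⟨v, hvm⟩ :=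
        moduleCat_surjective_g ((E A).shortExact hX) ⟨v, hvm⟩
      have hx' (B : {B : 𝒜 // B ≠ A}) (g : A ⟶ B.1) : actHom X g x = v B g :=
        DFunLike.congr_fun (congrFun (congrArg Subtype.val hx) B) g
      refine ⟨⟨y - evMap A i x, LinearMap.mem_ker.2 (funext fun B => HomModule.ext fun g => ?_)⟩,
        Subtype.ext ?_⟩
      · change actHom Y g (y - evMap A i x) = 0
        rw [map_sub, ← evMap_act, hx', hv, sub_self]
      · change evMap A p (y - evMap A i x) = z.1
        rw [map_sub, (hip A).apply_apply_eq_zero, sub_zero, hy]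
  -- k_A(X) → k_A(Y) → Y(A) is definitionally k_A(X) → X(A) → Y(A).
  · exact (E A).comp_mono (kSequence X A h𝒜).f (ModuleCat.ofHom (evMap A i))
      ⟨_, _, _, hX⟩ ⟨_, _, _, h A⟩

end Flat
end

/-! ### The free cover, and the canonical sequence of a c_A-flat functor. -/

noncomputable section

variable {R : Type u} [Ring R] {𝒜 : Type u} [SmallCategory 𝒜] [Preadditive 𝒜]

/-- The scalar action of `R` on `X(B)`, which is `R_B`-linear. -/
def scalar (X : 𝒜 ⥤+ ModuleCat.{u} R) (B : 𝒜) : R →+* Module.End (End B) (Ev B X) where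
  toFun r :=
    { toFun := fun x => HSMul.hSMul (β := X.obj.obj B) r x
      map_add' := fun x y => smul_add (A := X.obj.obj B) r x y
      map_smul' := fun f x => ((X.obj.map (End.asHom f)).hom.map_smul r x).symm }
  map_one' := LinearMap.ext fun x => one_smul (α := X.obj.obj B) R x
  map_mul' r s := LinearMap.ext fun x => mul_smul (β := X.obj.obj B) r s x
  map_zero' := LinearMap.ext fun x => zero_smul (M₀ := R) (A := X.obj.obj B) x
  map_add' r s := LinearMap.ext fun x => add_smul (M := X.obj.obj B) r s x

theorem actHom_scalar (X : 𝒜 ⥤+ ModuleCat.{u} R) {B C : 𝒜} (f : B ⟶ C) (r : R) (x : Ev B X) :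
    actHom X f (scalar X B r x) = scalar X C r (actHom X f x) :=
  (X.obj.map f).hom.map_smul r x

section FreeCover

variable (X : 𝒜 ⥤+ ModuleCat.{u} R)

/-- `⨁_B Hom(B, C) ⊗_{R_B} X(B)`. -/
def FreeObj (C : 𝒜) : Type u := ⨁ B : 𝒜, HomTensor B C (Ev B X)

instance (C : 𝒜) : AddCommGroup (FreeObj X C) :=
  inferInstanceAs (AddCommGroup (⨁ B : 𝒜, HomTensor B C (Ev B X)))

open Classical in
/-- The element `g ⊗ x`. -/
def FreeObj.single {B C : 𝒜} (g : B ⟶ C) (x : Ev B X) : FreeObj X C :=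
  DirectSum.of (fun B => HomTensor B C (Ev B X)) B (HomTensor.tmul g x)

variable {X}

@[elab_as_elim]
theorem FreeObj.induction {C : 𝒜} {P : FreeObj X C → Prop} (zero : P 0)
    (single : ∀ B (g : B ⟶ C) x, P (FreeObj.single X g x)) (add : ∀ a b, P a → P b → P (a + b))
    (t : FreeObj X C) : P t := by
  classical
  induction t using DirectSum.induction_on with
  | zero => exact zero
  | add a b ha hb => exact add _ _ ha hb
  | of B z =>
    induction z using HomTensor.induction with
    | zero => rw [map_zero]; exact zero
    | tmul g x => exact single B g x
    | add a b ha hb => rw [map_add]; exact add _ _ ha hb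

theorem FreeObj.hom_ext {C : 𝒜} {P : Type*} [AddCommGroup P] {a b : FreeObj X C →+ P}
    (h : ∀ B (g : B ⟶ C) x, a (FreeObj.single X g x) = b (FreeObj.single X g x)) : a = b := by
  ext t
  induction t using FreeObj.induction with
  | zero => simp
  | single B g x => exact h B g x
  | add s t hs ht => rw [map_add, map_add, hs, ht]

theorem FreeObj.single_add {B C : 𝒜} (g : B ⟶ C) (x y : Ev B X) :
    FreeObj.single X g (x + y) = FreeObj.single X g x + FreeObj.single X g y := by
  rw [FreeObj.single, HomTensor.tmul_add, map_add]
  rfl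

theorem FreeObj.add_single {B C : 𝒜} (g g' : B ⟶ C) (x : Ev B X) :
    FreeObj.single X (g + g') x = FreeObj.single X g x + FreeObj.single X g' x := by
  rw [FreeObj.single, HomTensor.add_tmul, map_add]
  rfl

@[simp] theorem FreeObj.single_zero {B C : 𝒜} (g : B ⟶ C) :
    FreeObj.single X g (0 : Ev B X) = 0 := by
  simpa using FreeObj.single_add g (0 : Ev B X) 0

theorem FreeObj.zero_single {B C : 𝒜} (x : Ev B X) :
    FreeObj.single X (0 : B ⟶ C) x = 0 := by
  simpa using FreeObj.add_single (0 : B ⟶ C) 0 x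

theorem FreeObj.single_comp {B C : 𝒜} (s : B ⟶ B) (g : B ⟶ C) (x : Ev B X) :
    FreeObj.single X (s ≫ g) x = FreeObj.single X g (actHom X s x) := by
  classical
  exact congrArg (DirectSum.of (fun B => HomTensor B C (Ev B X)) B)
    (HomTensor.tmul_smul (End.of s) g x).symm

variable (X)

/-- The scalar action of `R` through the factors `X(B)`. -/
def FreeObj.scalar (C : 𝒜) (r : R) : FreeObj X C →+ FreeObj X C :=
  DirectSum.map fun B => (HomTensor.map C (_root_.scalar X B r)).toAddMonoidHom

@[simp] theorem FreeObj.scalar_single {B C : 𝒜} (r : R) (g : B ⟶ C) (x : Ev B X) :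
    FreeObj.scalar X C r (FreeObj.single X g x) =
      FreeObj.single X g (_root_.scalar X B r x) := by
  classical
  exact DirectSum.map_of _ _ _

/-- The scalar action of `R` through the factors `X(B)`, as a homomorphism of rings. -/
def FreeObj.scalarHom (C : 𝒜) : R →+* AddMonoid.End (FreeObj X C) where
  toFun := FreeObj.scalar X C
  map_one' := FreeObj.hom_ext fun B g x => by
    rw [FreeObj.scalar_single, map_one]
    rfl
  map_mul' r s := FreeObj.hom_ext fun B g x => by
    change _ = FreeObj.scalar X C r (FreeObj.scalar X C s (FreeObj.single X g x))
    rw [FreeObj.scalar_single, map_mul, FreeObj.scalar_single, FreeObj.scalar_single]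
    rfl
  map_zero' := FreeObj.hom_ext fun B g x => by
    rw [FreeObj.scalar_single, map_zero]
    exact FreeObj.single_zero g
  map_add' r s := FreeObj.hom_ext fun B g x => by
    change _ = FreeObj.scalar X C r (FreeObj.single X g x) +
      FreeObj.scalar X C s (FreeObj.single X g x)
    rw [FreeObj.scalar_single, map_add, FreeObj.scalar_single, FreeObj.scalar_single]
    exact FreeObj.single_add g _ _

instance (C : 𝒜) : Module R (FreeObj X C) := Module.compHom _ (FreeObj.scalarHom X C)

theorem FreeObj.smul_single {B C : 𝒜} (r : R) (g : B ⟶ C) (x : Ev B X) :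
    r • FreeObj.single X g x = FreeObj.single X g (_root_.scalar X B r x) :=
  FreeObj.scalar_single X r g x

/-- Postcomposition with `f : C ⟶ D`, as an additive map. -/
def FreeObj.postcomp {C D : 𝒜} (f : C ⟶ D) : FreeObj X C →+ FreeObj X D :=
  DirectSum.map fun B => HomTensor.postcomp B D (Ev B X) f

@[simp] theorem FreeObj.postcomp_single {B C D : 𝒜} (f : C ⟶ D) (g : B ⟶ C) (x : Ev B X) :
    FreeObj.postcomp X f (FreeObj.single X g x) = FreeObj.single X (g ≫ f) x := by
  classical
  exact DirectSum.map_of _ _ _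

open Classical in
/-- `g ⊗ x ↦ X(g)(x)`, as an additive map. -/
def FreeObj.act (C : 𝒜) : FreeObj X C →+ Ev C X :=
  DirectSum.toAddMonoid fun B => (tensorAct X B C).toAddMonoidHom

@[simp] theorem FreeObj.act_single {B C : 𝒜} (g : B ⟶ C) (x : Ev B X) :
    FreeObj.act X C (FreeObj.single X g x) = actHom X g x := by
  classical
  exact DirectSum.toAddMonoid_of _ _ _

/-- The functor `⨁_B Hom(B, -) ⊗_{R_B} X(B)`. -/
def freeCover : 𝒜 ⥤+ ModuleCat.{u} R :=
  additiveFunctorMk (FreeObj X)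
    (fun f =>
      { FreeObj.postcomp X f with
        map_smul' := fun r t => by
          change FreeObj.postcomp X f (r • t) = r • FreeObj.postcomp X f t
          induction t using FreeObj.induction with
          | zero => simp
          | single B g x => simp [FreeObj.smul_single]
          | add a b ha hb => rw [smul_add, map_add, map_add, smul_add, ha, hb] })
    (fun C => DFunLike.congr_fun (f := FreeObj.postcomp X (𝟙 C)) (g := AddMonoidHom.id _)
      (FreeObj.hom_ext fun B g x => by simp))
    (fun f g => DFunLike.congr_fun (f := FreeObj.postcomp X (f ≫ g))
      (g := (FreeObj.postcomp X g).comp (FreeObj.postcomp X f))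
      (FreeObj.hom_ext fun B g x => by simp))
    (fun f g => DFunLike.congr_fun (f := FreeObj.postcomp X (f + g))
      (g := FreeObj.postcomp X f + FreeObj.postcomp X g)
      (FreeObj.hom_ext fun B g x => by simp [FreeObj.add_single]))

/-- The canonical epimorphism `⨁_B Hom(B, -) ⊗_{R_B} X(B) ⟶ X`. -/
def freeCoverπ : freeCover X ⟶ X :=
  ⟨{ app := fun C => ModuleCat.ofHom
      { FreeObj.act X C with
        map_smul' := fun r t => by
          change FreeObj.act X C (r • t) = scalar X C r (FreeObj.act X C t)
          induction t using FreeObj.induction with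
          | zero => simp
          | single B g x => simp [FreeObj.smul_single, actHom_scalar]
          | add a b ha hb => rw [smul_add, map_add, map_add, map_add, ha, hb] }
     naturality := fun C D f => ModuleCat.hom_ext (LinearMap.ext fun t => by
      have : (FreeObj.act X D).comp (FreeObj.postcomp X f) =
          (actHom X f).comp (FreeObj.act X C) :=
        FreeObj.hom_ext fun B g x => by simp [actHom_comp]
      exact DFunLike.congr_fun this t) }⟩

/-- The section `x ↦ id ⊗ x` of the canonical epimorphism at `C`, which is `R_C`-linear. -/
def freeCoverSection (C : 𝒜) : Ev C X →ₗ[End C] Ev C (freeCover X) where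
  toFun x := FreeObj.single X (𝟙 C) x
  map_add' := FreeObj.single_add (𝟙 C)
  map_smul' f x := by
    change FreeObj.single X (𝟙 C) (actHom X (End.asHom f) x) =
      FreeObj.postcomp X (End.asHom f) (FreeObj.single X (𝟙 C) x)
    rw [← FreeObj.single_comp, FreeObj.postcomp_single, Category.comp_id, Category.id_comp]

theorem freeCoverπ_section (C : 𝒜) (x : Ev C X) :
    evMap C (freeCoverπ X) (freeCoverSection X C x) = x :=
  (FreeObj.act_single X (𝟙 C) x).trans (actHom_id X C x)

theorem evMap_freeCoverπ_surjective (C : 𝒜) : Function.Surjective (evMap C (freeCoverπ X)) :=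
  fun x => ⟨_, freeCoverπ_section X C x⟩

variable {X} in
-- Here `δ_C(r) ∘ g ⊗ x = g ∘ δ_B(r) ⊗ x = g ⊗ r x`, the last step by compatibility of `X`.
theorem isCompatible_freeCover {δ : ∀ A : 𝒜, R →+* End A}
    (hδ : ∀ {A B : 𝒜} (f : A ⟶ B) (r : R), End.asHom (δ A r) ≫ f = f ≫ End.asHom (δ B r))
    (hX : IsCompatible δ X) : IsCompatible δ (freeCover X) := by
  intro C r t
  change FreeObj.postcomp X (End.asHom (δ C r)) t = FreeObj.scalar X C r t
  refine DFunLike.congr_fun (FreeObj.hom_ext fun B g x => ?_) t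
  rw [FreeObj.postcomp_single, FreeObj.scalar_single, ← hδ, FreeObj.single_comp]
  exact congrArg (FreeObj.single X g) (hX B r x)

/-- The short exact sequence of the canonical epimorphism. -/
def freeResolution : ShortComplex (𝒜 ⥤+ ModuleCat.{u} R) :=
  ShortComplex.mk (kernelι (freeCoverπ X)) (freeCoverπ X) (kernelι_comp _)

theorem isKernelCokernelPair_freeResolution : IsKernelCokernelPair (freeResolution X) :=
  isKernelCokernelPair_of_evMap _ _ _ (evMap_kernelι_injective _) (evMap_kernelι_exact _)
    (evMap_freeCoverπ_surjective X)

/-- The evaluation at `B` splits over `End B`, so the obscure axiom applies with the identity as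
admissible composite. -/
theorem ses_freeResolution (B : 𝒜) (E : ExactStructure (ModuleCat.{u} (End B))) :
    E.ses ((freeResolution X).map (ev B)) := by
  refine E.ses_of_isAdmissibleEpi_comp (moduleCat_shortExact (evMap_kernelι_injective _ B)
    (evMap_kernelι_exact _ B) (evMap_freeCoverπ_surjective X B))
    (ModuleCat.ofHom (freeCoverSection X B)) ?_
  have : ModuleCat.ofHom (freeCoverSection X B) ≫ ((freeResolution X).map (ev B)).g =
      𝟙 (ModuleCat.of (End B) (Ev B X)) :=
    ModuleCat.hom_ext (LinearMap.ext (freeCoverπ_section X B))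
  exact this ▸ E.id_epi _

variable (A : 𝒜)

open Classical in
/-- The projection onto the summands with `B ≠ A`. -/
def FreeObj.proj : FreeObj X A →+ TensorSum X A :=
  DirectSum.toAddMonoid fun B =>
    if h : B ≠ A then
      DirectSum.of (fun B : {B : 𝒜 // B ≠ A} => HomTensor B.1 A (Ev B.1 X)) ⟨B, h⟩
    else 0

theorem FreeObj.proj_single (B : {B : 𝒜 // B ≠ A}) (g : B.1 ⟶ A) (x : Ev B.1 X) :
    FreeObj.proj X A (FreeObj.single X g x) = TensorSum.single X B g x := by
  classical
  rw [FreeObj.proj, FreeObj.single]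
  refine (DirectSum.toAddMonoid_of _ _ _).trans ?_
  rw [dif_pos B.2]
  rfl

theorem FreeObj.proj_single_self (g : A ⟶ A) (x : Ev A X) :
    FreeObj.proj X A (FreeObj.single X g x) = 0 := by
  classical
  rw [FreeObj.proj, FreeObj.single]
  refine (DirectSum.toAddMonoid_of _ _ _).trans ?_
  rw [dif_neg (by simp)]
  rfl

open Classical in
/-- The inclusion of the summands with `B ≠ A`. -/
def FreeObj.incl : TensorSum X A →+ FreeObj X A :=
  DirectSum.toAddMonoid fun B => DirectSum.of (fun B => HomTensor B A (Ev B X)) B.1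

@[simp] theorem FreeObj.incl_single (B : {B : 𝒜 // B ≠ A}) (g : B.1 ⟶ A) (x : Ev B.1 X) :
    FreeObj.incl X A (TensorSum.single X B g x) = FreeObj.single X g x := by
  classical
  exact DirectSum.toAddMonoid_of _ _ _

variable {X A}

theorem FreeObj.proj_incl (t : TensorSum X A) : FreeObj.proj X A (FreeObj.incl X A t) = t := by
  induction t using TensorSum.induction with
  | zero => simp
  | single B g x => rw [FreeObj.incl_single, FreeObj.proj_single]
  | add a b ha hb => rw [map_add, map_add, ha, hb]

theorem FreeObj.act_incl (t : TensorSum X A) : FreeObj.act X A (FreeObj.incl X A t) =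
    varphi X A t := by
  induction t using TensorSum.induction with
  | zero => simp
  | single B g x => simp
  | add a b ha hb => rw [map_add, map_add, map_add, ha, hb]

/-- The element `g ⊗ x` is the image under `g` of `id ⊗ x`, which lives at `B ≠ A`. -/
theorem FreeObj.single_mem_range_varphi (B : {B : 𝒜 // B ≠ A}) (g : B.1 ⟶ A) (x : Ev B.1 X) :
    (FreeObj.single X g x : Ev A (freeCover X)) ∈ LinearMap.range (varphi (freeCover X) A) := by
  refine ⟨TensorSum.single (freeCover X) B g (FreeObj.single X (𝟙 B.1) x), ?_⟩
  refine (varphi_single (X := freeCover X) B g _).trans ?_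
  refine (FreeObj.postcomp_single X g (𝟙 B.1) x).trans ?_
  rw [Category.id_comp]

theorem FreeObj.incl_mem_range_varphi (t : TensorSum X A) :
    (FreeObj.incl X A t : Ev A (freeCover X)) ∈ LinearMap.range (varphi (freeCover X) A) := by
  induction t using TensorSum.induction with
  | zero => rw [map_zero]; exact zero_mem _
  | single B g x => rw [FreeObj.incl_single]; exact FreeObj.single_mem_range_varphi B g x
  | add a b ha hb => rw [map_add]; exact add_mem ha hb

/-- For `t = f ⊗ x` with `f : B ⟶ C` and `B ≠ A`, the difference is, up to sign, a relation of the
first kind. If `B = A`, the projection kills `g ∘ f ⊗ x`, and the remaining term `g ⊗ X(f)(x)` is a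
relation of the second kind. -/
theorem FreeObj.proj_postcomp_sub_mem (C : {C : 𝒜 // C ≠ A})
    (g : C.1 ⟶ A) (t : FreeObj X C.1) :
    FreeObj.proj X A (FreeObj.postcomp X g t) - TensorSum.single X C g (FreeObj.act X C.1 t) ∈
      LinearMap.range (phi X A) := by
  let σ : Ev C.1 X →+ TensorSum X A :=
    AddMonoidHom.mk' (TensorSum.single X C g) (TensorSum.single_add C g)
  let θ : FreeObj X C.1 →+ TensorSum X A :=
    (FreeObj.proj X A).comp (FreeObj.postcomp X g) - σ.comp (FreeObj.act X C.1)
  change θ t ∈ LinearMap.range (phi X A)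
  induction t using FreeObj.induction with
  | zero => rw [map_zero]; exact zero_mem _
  | single B f x =>
    change FreeObj.proj X A (FreeObj.postcomp X g (FreeObj.single X f x)) -
      TensorSum.single X C g (FreeObj.act X C.1 (FreeObj.single X f x)) ∈ _
    rw [FreeObj.postcomp_single, FreeObj.act_single]
    by_cases hB : B = A
    · subst hB
      rw [FreeObj.proj_single_self, zero_sub]
      exact neg_mem (single_actHom_mem_range_phi C f g x)
    · rw [FreeObj.proj_single X A ⟨B, hB⟩, ← neg_sub]
      exact neg_mem (single_sub_single_mem_range_phi ⟨B, hB⟩ C f g x)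
  | add a b ha hb => rw [map_add]; exact add_mem ha hb

/-- The image of `varphi` of the kernel of the free cover of `X` projects into the image of
`phi`. -/
theorem FreeObj.proj_mem_range_phi (t : TensorSum (kernelFunctor (freeCoverπ X)) A) :
    FreeObj.proj X A (evMap A (kernelι (freeCoverπ X)) (varphi _ A t)) ∈
      LinearMap.range (phi X A) := by
  induction t using TensorSum.induction with
  | zero => rw [map_zero, map_zero]; exact (map_zero (FreeObj.proj X A)).symm ▸ zero_mem _
  | single C g y =>
    have h := FreeObj.proj_postcomp_sub_mem C g (evMap C.1 (kernelι (freeCoverπ X)) y)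
    have h0 : FreeObj.act X C.1 (evMap C.1 (kernelι (freeCoverπ X)) y) = 0 :=
      (evMap_kernelι_exact (freeCoverπ X) C.1).apply_apply_eq_zero y
    rw [h0, TensorSum.single_zero, sub_zero] at h
    rw [varphi_single, evMap_act]
    exact h
  | add a b ha hb =>
    rw [map_add, map_add]
    exact (map_add (FreeObj.proj X A) _ _).symm ▸ add_mem ha hb

open Classical in
/-- The retraction of `x ↦ id ⊗ x` at `A` killing the summands with `B ≠ A`. -/
def FreeObj.retract (A : 𝒜) : FreeObj X A →+ Ev A X :=
  DirectSum.toAddMonoid fun B => if B = A then (tensorAct X B A).toAddMonoidHom else 0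

theorem FreeObj.retract_single_self (g : A ⟶ A) (x : Ev A X) :
    FreeObj.retract A (FreeObj.single X g x) = actHom X g x := by
  classical
  rw [FreeObj.retract, FreeObj.single]
  refine (DirectSum.toAddMonoid_of _ _ _).trans ?_
  rw [if_pos rfl]
  rfl

theorem FreeObj.retract_single {B : 𝒜} (hB : B ≠ A) (g : B ⟶ A) (x : Ev B X) :
    FreeObj.retract A (FreeObj.single X g x) = 0 := by
  classical
  rw [FreeObj.retract, FreeObj.single]
  refine (DirectSum.toAddMonoid_of _ _ _).trans ?_
  rw [if_neg hB]
  rfl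

/-- On the summand of F(C) at `A` the composites `A ⟶ C ⟶ A` are zero; the other summands are killed
by the retraction. -/
theorem FreeObj.retract_varphi (h𝒜 : HasZeroRoundTrips 𝒜) (t : TensorSum (freeCover X) A) :
    FreeObj.retract A (varphi (freeCover X) A t : FreeObj X A) = 0 := by
  induction t using TensorSum.induction with
  | zero => rw [map_zero]; exact map_zero (FreeObj.retract A)
  | single C g t =>
    rw [varphi_single]
    change (FreeObj.retract A).comp (FreeObj.postcomp X g) t = 0
    refine DFunLike.congr_fun (g := (0 : FreeObj X C.1 →+ Ev A X))
      (FreeObj.hom_ext fun B f x => ?_) t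
    rw [AddMonoidHom.comp_apply, FreeObj.postcomp_single]
    by_cases hB : B = A
    · subst hB
      rw [h𝒜 C.1 B C.2 f g, FreeObj.zero_single, map_zero]
      rfl
    · rw [FreeObj.retract_single hB]
      rfl
  | add a b ha hb =>
    rw [map_add]
    exact (map_add (FreeObj.retract A) _ _).trans (by rw [ha, hb, add_zero])

/-- `c_A` of the free cover of `X` is `X(A)`. -/
theorem FreeObj.mkQ_section_bijective (h𝒜 : HasZeroRoundTrips 𝒜) :
    Function.Bijective
      ((LinearMap.range (varphi (freeCover X) A)).mkQ ∘ₗ freeCoverSection X A) := by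
  constructor
  · refine (injective_iff_map_eq_zero _).2 fun x hx => ?_
    obtain ⟨t, ht⟩ : freeCoverSection X A x ∈ LinearMap.range (varphi (freeCover X) A) :=
      (Submodule.Quotient.mk_eq_zero _).1 hx
    rw [← actHom_id X A x, ← FreeObj.retract_single_self]
    exact (congrArg (FreeObj.retract A) ht.symm).trans (FreeObj.retract_varphi h𝒜 t)
  · intro y
    obtain ⟨t, rfl⟩ := Submodule.mkQ_surjective (LinearMap.range (varphi (freeCover X) A)) y
    let π : FreeObj X A →+ CObj (freeCover X) A :=
      (LinearMap.range (varphi (freeCover X) A)).mkQ.toAddMonoidHom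
    change ∃ x, π (FreeObj.single X (𝟙 A) x) = π t
    change FreeObj X A at t
    -- Modulo the image of `varphi` only the summand at `A` survives, and there `g ⊗ x = id ⊗
    -- X(g)(x)`.
    induction t using FreeObj.induction with
    | zero => exact ⟨0, by rw [FreeObj.single_zero]⟩
    | single B g x =>
      by_cases hB : B = A
      · subst hB
        refine ⟨actHom X g x, congrArg π ?_⟩
        rw [← FreeObj.single_comp, Category.comp_id]
      · refine ⟨0, ?_⟩
        rw [FreeObj.single_zero, map_zero]
        exact ((Submodule.Quotient.mk_eq_zero (LinearMap.range (varphi (freeCover X) A))).2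
          (FreeObj.single_mem_range_varphi ⟨B, hB⟩ g x)).symm
    | add a b ha hb =>
      obtain ⟨x, hx⟩ := ha
      obtain ⟨y, hy⟩ := hb
      exact ⟨x + y, by rw [FreeObj.single_add, map_add, map_add, hx, hy]⟩

/-- If `c_A` preserves the short exact sequence of the free cover of `X`, then the canonical
sequence of `X` is short exact. -/
theorem ses_cSequence (h𝒜 : HasZeroRoundTrips 𝒜) (E : ExactStructure (ModuleCat.{u} (End A)))
    (h : E.ses ((freeResolution X).map (cFunctor A))) : E.ses (cSequence X A h𝒜) := by
  refine E.ses_of_isAdmissibleEpi ?_ ?_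
  · refine moduleCat_shortExact ?_ ?_ (Submodule.mkQ_surjective _)
    · refine (injective_iff_map_eq_zero _).2 fun l hl => ?_
      obtain ⟨l, rfl⟩ := Submodule.mkQ_surjective (LinearMap.range (phi X A)) l
      -- As `varphi` kills `l`, its inclusion in F(A) lies in the kernel K(A). It also vanishes in
      -- c_A(F), so injectivity of c_A(K) → c_A(F) puts `y` in the image of `varphi` for K.
      obtain ⟨y, hy⟩ := (evMap_kernelι_exact (freeCoverπ X) A (FreeObj.incl X A l)).1
        ((FreeObj.act_incl l).trans hl)
      have hy0 : (Submodule.Quotient.mk y : CObj (kernelFunctor (freeCoverπ X)) A) = 0 := by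
        refine (injective_iff_map_eq_zero _).1 (moduleCat_injective_f (E.shortExact h)) _ ?_
        refine (Submodule.Quotient.mk_eq_zero _).2 ?_
        exact hy ▸ FreeObj.incl_mem_range_varphi l
      obtain ⟨t, rfl⟩ := (Submodule.Quotient.mk_eq_zero _).1 hy0
      refine (Submodule.Quotient.mk_eq_zero _).2 ?_
      rw [← FreeObj.proj_incl l, ← hy]
      exact FreeObj.proj_mem_range_phi t
    · intro x
      refine (Submodule.Quotient.mk_eq_zero _).trans ⟨?_, ?_⟩
      · rintro ⟨t, rfl⟩
        exact ⟨Submodule.Quotient.mk t, rfl⟩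
      · rintro ⟨t, rfl⟩
        obtain ⟨t, rfl⟩ := Submodule.mkQ_surjective (LinearMap.range (phi X A)) t
        exact ⟨t, rfl⟩
  -- Through the isomorphism X(A) ≅ c_A(F), the quotient map of X(A) is c_A of the cover.
  · let e : ModuleCat.of (End A) (Ev A X) ⟶ (cFunctor A).obj (freeCover X) := ModuleCat.ofHom
      ((LinearMap.range (varphi (freeCover X) A)).mkQ ∘ₗ freeCoverSection X A)
    have : IsIso e := (ConcreteCategory.isIso_iff_bijective e).2
      (FreeObj.mkQ_section_bijective h𝒜)
    have he : (cSequence X A h𝒜).g = e ≫ (cFunctor A).map (freeCoverπ X) :=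
      ModuleCat.hom_ext (LinearMap.ext fun x =>
        congrArg (LinearMap.range (varphi X A)).mkQ (freeCoverπ_section X A x).symm)
    rw [he]
    exact E.comp_epi _ _ (E.isAdmissibleEpi_of_isIso e) ⟨_, _, _, h⟩

end FreeCover
end

/-! ### The cofree hull, and the canonical sequence of a k_A-coflat functor. -/

noncomputable section

variable {R : Type u} [Ring R] {𝒜 : Type u} [SmallCategory 𝒜] [Preadditive 𝒜]

section CofreeHull

variable (X : 𝒜 ⥤+ ModuleCat.{u} R)

/-- `∏_B Hom_{R_B}(Hom(C, B), X(B))`. -/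
def CofreeObj (C : 𝒜) : Type u := ∀ B : 𝒜, HomModule C B (Ev B X)

instance (C : 𝒜) : AddCommGroup (CofreeObj X C) :=
  inferInstanceAs (AddCommGroup (∀ B : 𝒜, HomModule C B (Ev B X)))

variable {X}

theorem CofreeObj.ext {C : 𝒜} {u v : CofreeObj X C} (h : ∀ B (g : C ⟶ B), u B g = v B g) : u = v :=
  funext fun B => HomModule.ext (h B)

theorem CofreeObj.apply_comp {C B : 𝒜} (u : CofreeObj X C) (g : C ⟶ B) (s : B ⟶ B) :
    u B (g ≫ s) = actHom X s (u B g) :=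
  map_smul (u B) (End.of s) g

theorem CofreeObj.apply_zero {C B : 𝒜} (u : CofreeObj X C) : u B (0 : C ⟶ B) = 0 :=
  map_zero (u B)

variable (X)

instance (C : 𝒜) : Module R (CofreeObj X C) where
  smul r u := fun B => HomModule.map C (scalar X B r) (u B)
  one_smul u := CofreeObj.ext fun B g => DFunLike.congr_fun (map_one (scalar X B)) (u B g)
  mul_smul r s u := CofreeObj.ext fun B g => DFunLike.congr_fun (map_mul (scalar X B) r s) (u B g)
  smul_zero r := CofreeObj.ext fun B _ => map_zero (scalar X B r)
  smul_add r u v := CofreeObj.ext fun B g => map_add (scalar X B r) (u B g) (v B g)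
  add_smul r s u := CofreeObj.ext fun B g => DFunLike.congr_fun (map_add (scalar X B) r s) (u B g)
  zero_smul u := CofreeObj.ext fun B g => DFunLike.congr_fun (map_zero (scalar X B)) (u B g)

/-- Precomposition with `f : C ⟶ D`. -/
def CofreeObj.precomp {C D : 𝒜} (f : C ⟶ D) : CofreeObj X C →ₗ[R] CofreeObj X D where
  toFun u B :=
    ({ toFun := fun g => u B (f ≫ g)
       map_add' := fun g g' => by rw [Preadditive.comp_add, map_add]
       map_smul' := fun s g => by
        rw [RingHom.id_apply, ← map_smul]
        exact congrArg (u B) (Category.assoc _ _ _).symm } : (D ⟶ B) →ₗ[End B] Ev B X)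
  map_add' _ _ := rfl
  map_smul' _ _ := rfl

theorem CofreeObj.precomp_apply {C D B : 𝒜} (f : C ⟶ D) (u : CofreeObj X C) (g : D ⟶ B) :
    CofreeObj.precomp X f u B g = u B (f ≫ g) := rfl

/-- The functor `∏_B Hom_{R_B}(Hom(-, B), X(B))`. -/
def cofreeHull : 𝒜 ⥤+ ModuleCat.{u} R :=
  additiveFunctorMk (CofreeObj X) (CofreeObj.precomp X)
    (fun C u => CofreeObj.ext fun B g => congrArg (u B) (Category.id_comp g))
    (fun f f' u => CofreeObj.ext fun B g => congrArg (u B) (Category.assoc f f' g))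
    (fun f f' u => CofreeObj.ext fun B g => by
      rw [CofreeObj.precomp_apply, Preadditive.add_comp]
      exact map_add (u B) _ _)

/-- The canonical monomorphism `X ⟶ ∏_B Hom_{R_B}(Hom(-, B), X(B))`. -/
def cofreeHullι : X ⟶ cofreeHull X :=
  ⟨{ app := fun C => ModuleCat.ofHom
      { toFun := fun x => (fun B => coAct X C B x : CofreeObj X C)
        map_add' := fun x y => funext fun B => map_add (coAct X C B) x y
        map_smul' := fun r x => CofreeObj.ext fun _ g => actHom_scalar X g r x }
     naturality := fun _ _ f => ModuleCat.hom_ext (LinearMap.ext fun x =>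
      CofreeObj.ext fun _ g => (actHom_comp X f g x).symm) }⟩

/-- The retraction `u ↦ u(id)` of the canonical monomorphism at `C`, which is `R_C`-linear. -/
def cofreeHullRetraction (C : 𝒜) : Ev C (cofreeHull X) →ₗ[End C] Ev C X where
  toFun u := (u : CofreeObj X C) C (𝟙 C)
  map_add' _ _ := rfl
  map_smul' f u := by
    change CofreeObj X C at u
    change u C (End.asHom f ≫ 𝟙 C) = actHom X (End.asHom f) (u C (𝟙 C))
    rw [← CofreeObj.apply_comp, Category.comp_id, Category.id_comp]

theorem cofreeHull_retraction_ι (C : 𝒜) (x : Ev C X) :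
    cofreeHullRetraction X C (evMap C (cofreeHullι X) x) = x :=
  actHom_id X C x

theorem evMap_cofreeHullι_injective (C : 𝒜) : Function.Injective (evMap C (cofreeHullι X)) :=
  Function.LeftInverse.injective (cofreeHull_retraction_ι X C)

variable {X} in
theorem isCompatible_cofreeHull {δ : ∀ A : 𝒜, R →+* End A}
    (hδ : ∀ {A B : 𝒜} (f : A ⟶ B) (r : R), End.asHom (δ A r) ≫ f = f ≫ End.asHom (δ B r))
    (hX : IsCompatible δ X) : IsCompatible δ (cofreeHull X) := by
  intro C r u
  refine CofreeObj.ext fun B g => ?_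
  change CofreeObj X C at u
  change u B (End.asHom (δ C r) ≫ g) = scalar X B r (u B g)
  rw [hδ, CofreeObj.apply_comp]
  exact hX B r _

/-- The short exact sequence of the canonical monomorphism. -/
def cofreeResolution : ShortComplex (𝒜 ⥤+ ModuleCat.{u} R) :=
  ShortComplex.mk (cofreeHullι X) (cokernelπ (cofreeHullι X)) (comp_cokernelπ _)

theorem isKernelCokernelPair_cofreeResolution : IsKernelCokernelPair (cofreeResolution X) :=
  isKernelCokernelPair_of_evMap _ _ _ (evMap_cofreeHullι_injective X) (evMap_cokernelπ_exact _)
    (evMap_cokernelπ_surjective _)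

/-- The evaluation at `B` splits over `End B`, so the dual obscure axiom applies with the identity.
-/
theorem ses_cofreeResolution (B : 𝒜) (E : ExactStructure (ModuleCat.{u} (End B))) :
    E.ses ((cofreeResolution X).map (ev B)) := by
  refine E.ses_of_isAdmissibleMono_comp (moduleCat_shortExact (evMap_cofreeHullι_injective X B)
    (evMap_cokernelπ_exact _ B) (evMap_cokernelπ_surjective _ B))
    (ModuleCat.ofHom (cofreeHullRetraction X B)) ?_
  have : ((cofreeResolution X).map (ev B)).f ≫ ModuleCat.ofHom (cofreeHullRetraction X B) =
      𝟙 (ModuleCat.of (End B) (Ev B X)) :=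
    ModuleCat.hom_ext (LinearMap.ext (cofreeHull_retraction_ι X B))
  exact this ▸ E.id_mono _

variable {X} {A : 𝒜}

theorem CofreeObj.mem_ker_psi {u : CofreeObj X A} :
    (u : Ev A (cofreeHull X)) ∈ LinearMap.ker (psi (cofreeHull X) A) ↔
      ∀ (C : {C : 𝒜 // C ≠ A}) (f : A ⟶ C.1) (B : 𝒜) (g : C.1 ⟶ B), u B (f ≫ g) = 0 := by
  refine (LinearMap.mem_ker (f := psi (cofreeHull X) A)).trans ⟨fun h C f B g => ?_, fun h => funext fun C => HomModule.ext
    fun f => CofreeObj.ext fun B g => h C f B g⟩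
  have h1 : CofreeObj.precomp X f u = 0 := DFunLike.congr_fun (congrFun h C) f
  exact DFunLike.congr_fun (congrFun h1 B) g

/-- Since `B ≠ A`, the arrow `g` itself may serve as the first factor, followed by `𝟙 B`. -/
theorem CofreeObj.apply_eq_zero_of_mem_ker_psi {u : CofreeObj X A}
    (hu : (u : Ev A (cofreeHull X)) ∈ LinearMap.ker (psi (cofreeHull X) A))
    {B : 𝒜} (hB : B ≠ A) (g : A ⟶ B) : u B g = 0 := by
  have := CofreeObj.mem_ker_psi.1 hu ⟨B, hB⟩ g B (𝟙 B)
  rwa [Category.comp_id] at this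

/-- `k_A` of the cofree hull of `X` is `X(A)`. -/
theorem CofreeObj.retraction_bijective (h𝒜 : HasZeroRoundTrips 𝒜) :
    Function.Bijective
      (cofreeHullRetraction X A ∘ₗ (LinearMap.ker (psi (cofreeHull X) A)).subtype) := by
  classical
  constructor
  · refine (injective_iff_map_eq_zero _).2 fun u hu => Subtype.ext ?_
    refine CofreeObj.ext (v := 0) fun B g => ?_
    by_cases hB : B = A
    · subst hB
      -- By linearity the component at `A` is determined by its value at the identity, which is
      -- zero.
      have h := CofreeObj.apply_comp (u.1 : CofreeObj X B) (𝟙 B) g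
      rw [Category.id_comp] at h
      exact h.trans ((congrArg (actHom X g) hu).trans (map_zero _))
    · exact CofreeObj.apply_eq_zero_of_mem_ker_psi u.2 hB g
  · intro x
    -- The preimage of `x` is `g ↦ X(g)(x)` at `A` and zero elsewhere; it lies in k_A because round
    -- trips from `A` vanish.
    let u : CofreeObj X A := Pi.single A (coAct X A A x)
    have hu : u A = coAct X A A x := Pi.single_eq_same _ _
    have hu' (B : 𝒜) (hB : B ≠ A) : u B = 0 := Pi.single_eq_of_ne hB _
    refine ⟨⟨u, CofreeObj.mem_ker_psi.2 fun C f B g => ?_⟩, ?_⟩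
    · by_cases hB : B = A
      · subst hB
        rw [h𝒜 C.1 B C.2 f g, CofreeObj.apply_zero]
      · rw [hu' B hB]
        rfl
    · change u A (𝟙 A) = x
      rw [hu]
      exact actHom_id X A x

open Classical in
/-- The extension by zero of a family indexed by the objects `B ≠ A`. -/
def CofreeObj.extend (v : HomProd X A) : CofreeObj X A :=
  fun B => if h : B ≠ A then v ⟨B, h⟩ else 0

theorem CofreeObj.extend_apply (v : HomProd X A) (B : {B : 𝒜 // B ≠ A}) (g : A ⟶ B.1) :
    CofreeObj.extend v B.1 g = v B g := by
  rw [CofreeObj.extend, dif_pos B.2]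

theorem CofreeObj.extend_apply_self (v : HomProd X A) (g : A ⟶ A) :
    CofreeObj.extend v A g = 0 := by
  rw [CofreeObj.extend, dif_neg (by simp)]
  rfl

/-- The equations defining ker mu say exactly this: the component `t₁ - t₂` gives it at `B ≠ A`, and
`tau` gives it at `A`, where the extension is zero. -/
theorem CofreeObj.precomp_extend {v : HomProd X A} (hv : v ∈ LinearMap.ker (mu X A))
    (C : {C : 𝒜 // C ≠ A}) (f : A ⟶ C.1) :
    CofreeObj.precomp X f (CofreeObj.extend v) = fun B => coAct X C.1 B (v C f) := by
  refine CofreeObj.ext fun B g => ?_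
  change CofreeObj.extend v B (f ≫ g) = actHom X g (v C f)
  by_cases hB : B = A
  · subst hB
    rw [CofreeObj.extend_apply_self]
    have h := DFunLike.congr_fun (DFunLike.congr_fun
      (congrFun (congrArg Prod.snd (LinearMap.mem_ker.1 hv)) C) f) g
    exact h.symm
  · have h := DFunLike.congr_fun (DFunLike.congr_fun
      (congrFun (congrArg Prod.fst (LinearMap.mem_ker.1 hv)) (C, ⟨B, hB⟩)) f) g
    exact (CofreeObj.extend_apply v ⟨B, hB⟩ (f ≫ g)).trans (sub_eq_zero.1 h).symm

/-- If `k_A` preserves the short exact sequence of the cofree hull of `X`, then the canonical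
sequence of `X` is short exact. -/
theorem ses_kSequence (h𝒜 : HasZeroRoundTrips 𝒜) (E : ExactStructure (ModuleCat.{u} (End A)))
    (h : E.ses ((cofreeResolution X).map (kFunctor A))) : E.ses (kSequence X A h𝒜) := by
  refine E.ses_of_isAdmissibleMono ?_ ?_
  · refine moduleCat_shortExact Subtype.val_injective ?_ ?_
    · intro x
      constructor
      · intro hx
        exact ⟨⟨x, congrArg Subtype.val hx⟩, rfl⟩
      · rintro ⟨x, rfl⟩
        exact Subtype.ext x.2
    · rintro ⟨v, hv⟩
      let z : Ev A (cokernelFunctor (cofreeHullι X)) :=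
        evMap A (cokernelπ (cofreeHullι X)) (CofreeObj.extend v)
      have hz : z ∈ LinearMap.ker (psi _ A) := by
        refine LinearMap.mem_ker.2 (funext fun C => HomModule.ext fun f => ?_)
        refine (evMap_act (cokernelπ (cofreeHullι X)) f (CofreeObj.extend v)).symm.trans ?_
        exact (evMap_cokernelπ_exact (cofreeHullι X) C.1 _).2
          ⟨v C f, (CofreeObj.precomp_extend hv C f).symm⟩
      -- Surjectivity of k_A from the hull to the cokernel replaces the extension by some `u` with
      -- the same class. The difference comes from an `x` in X(A), and since `u` vanishes at every
      -- `B ≠ A`, `psi` sends `x` to `v`.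
      obtain ⟨u, hu⟩ : ∃ u : KObj (cofreeHull X) A,
          evMap A (cokernelπ (cofreeHullι X)) u.1 = z := by
        obtain ⟨u, hu⟩ := moduleCat_surjective_g (E.shortExact h) ⟨z, hz⟩
        exact ⟨u, congrArg Subtype.val hu⟩
      let v' : Ev A (cofreeHull X) := CofreeObj.extend v
      obtain ⟨x, hx⟩ := (evMap_cokernelπ_exact (cofreeHullι X) A (v' - u.1)).1
        ((map_sub (evMap A (cokernelπ (cofreeHullι X))) _ _).trans (sub_eq_zero.2 hu.symm))
      refine ⟨x, Subtype.ext (funext fun B => HomModule.ext fun g => ?_)⟩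
      have h1 := DFunLike.congr_fun (congrFun hx B.1) g
      refine h1.trans ?_
      change CofreeObj.extend v B.1 g - (u.1 : CofreeObj X A) B.1 g = v B g
      rw [CofreeObj.apply_eq_zero_of_mem_ker_psi u.2 B.2, sub_zero, CofreeObj.extend_apply]
  -- Through the isomorphism of k_A of the hull with X(A), the inclusion of k_A(X) is k_A of the
  -- hull map.
  · let e : (kFunctor A).obj (cofreeHull X) ⟶ ModuleCat.of (End A) (Ev A X) := ModuleCat.ofHom
      (cofreeHullRetraction X A ∘ₗ (LinearMap.ker (psi (cofreeHull X) A)).subtype)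
    have : IsIso e := (ConcreteCategory.isIso_iff_bijective e).2
      (CofreeObj.retraction_bijective h𝒜)
    have he : (kSequence X A h𝒜).f = (kFunctor A).map (cofreeHullι X) ≫ e :=
      ModuleCat.hom_ext (LinearMap.ext fun x => (cofreeHull_retraction_ι X A x.1).symm)
    rw [he]
    exact E.comp_mono _ _ ⟨_, _, _, h⟩ (E.isAdmissibleMono_of_isIso e)

end CofreeHull
end

/-! ### Both equivalences, for all additive functors and for the compatible ones. -/

theorem proposition5p18 {R : Type u} [Ring R] {𝒜 : Type u} [SmallCategory 𝒜] [Preadditive 𝒜]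
    (δ : ∀ A : 𝒜, R →+* End A)
    (hδ : ∀ {A B : 𝒜} (f : A ⟶ B) (r : R), End.asHom (δ A r) ≫ f = f ≫ End.asHom (δ B r))
    (h𝒜 : HasZeroRoundTrips 𝒜)
    (E : ∀ A : 𝒜, ExactStructure (ModuleCat.{u} (End A))) (A : 𝒜) :
    (∀ X : 𝒜 ⥤+ ModuleCat.{u} R,
      (IsFlatObject (degreewise ev E) (E A).ses (cFunctor A) X ↔
        (E A).ses (cSequence X A h𝒜)) ∧
      (IsCoflatObject (degreewise ev E) (E A).ses (kFunctor A) X ↔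
        (E A).ses (kSequence X A h𝒜))) ∧
    (∀ X : (IsCompatible (R := R) δ).FullSubcategory,
      (IsFlatObject (degreewise (fun B => (IsCompatible δ).ι ⋙ ev B) E) (E A).ses
          ((IsCompatible δ).ι ⋙ cFunctor A) X ↔
        (E A).ses (cSequence X.obj A h𝒜)) ∧
      (IsCoflatObject (degreewise (fun B => (IsCompatible δ).ι ⋙ ev B) E) (E A).ses
          ((IsCompatible δ).ι ⋙ kFunctor A) X ↔
        (E A).ses (kSequence X.obj A h𝒜))) := by
  refine ⟨fun X => ⟨⟨fun h => ?_, fun h Y Z i p w hS => ?_⟩,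
    ⟨fun h => ?_, fun h Y Z i p w hS => ?_⟩⟩,
    fun X => ⟨⟨fun h => ?_, fun h Y Z i p w hS => ?_⟩,
    ⟨fun h => ?_, fun h Y Z i p w hS => ?_⟩⟩⟩
  · exact ses_cSequence h𝒜 (E A) (h _ _ _ _ _
      ⟨isKernelCokernelPair_freeResolution X, fun B => ses_freeResolution X B (E B)⟩)
  · exact ses_map_cFunctor h𝒜 E A i p w hS.2 h
  · exact ses_kSequence h𝒜 (E A) (h _ _ _ _ _
      ⟨isKernelCokernelPair_cofreeResolution X, fun B => ses_cofreeResolution X B (E B)⟩)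
  · exact ses_map_kFunctor h𝒜 E A i p w hS.2 h
  -- The free resolution lies in the full subcategory, whose inclusion reflects kernel-cokernel
  -- pairs.
  · let Z : (IsCompatible (R := R) δ).FullSubcategory :=
      ⟨freeCover X.obj, isCompatible_freeCover hδ X.property⟩
    let Y : (IsCompatible (R := R) δ).FullSubcategory :=
      ⟨kernelFunctor (freeCoverπ X.obj), isCompatible_kernelFunctor _ Z.property⟩
    let i : Y ⟶ Z := ⟨kernelι (freeCoverπ X.obj)⟩
    let p : Z ⟶ X := ⟨freeCoverπ X.obj⟩
    have w : i ≫ p = 0 := ObjectProperty.hom_ext _ (kernelι_comp (freeCoverπ X.obj))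
    exact ses_cSequence h𝒜 (E A) (h Y Z i p w
      ⟨IsKernelCokernelPair.of_map (IsCompatible δ).ι
        (isKernelCokernelPair_freeResolution X.obj),
      fun B => ses_freeResolution X.obj B (E B)⟩)
  · exact ses_map_cFunctor h𝒜 E A i.hom p.hom (congrArg InducedCategory.Hom.hom w) hS.2 h
  -- The cofree resolution lies in the subcategory as well.
  · let Y : (IsCompatible (R := R) δ).FullSubcategory :=
      ⟨cofreeHull X.obj, isCompatible_cofreeHull hδ X.property⟩
    let Z : (IsCompatible (R := R) δ).FullSubcategory :=
      ⟨cokernelFunctor (cofreeHullι X.obj), isCompatible_cokernelFunctor _ Y.property⟩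
    let i : X ⟶ Y := ⟨cofreeHullι X.obj⟩
    let p : Y ⟶ Z := ⟨cokernelπ (cofreeHullι X.obj)⟩
    have w : i ≫ p = 0 := ObjectProperty.hom_ext _ (comp_cokernelπ (cofreeHullι X.obj))
    exact ses_kSequence h𝒜 (E A) (h Y Z i p w
      ⟨IsKernelCokernelPair.of_map (IsCompatible δ).ι
        (isKernelCokernelPair_cofreeResolution X.obj),
      fun B => ses_cofreeResolution X.obj B (E B)⟩)
  · exact ses_map_kFunctor h𝒜 E A i.hom p.hom (congrArg InducedCategory.Hom.hom w) hS.2 h
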